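/- All graphs are finite and simple. For a graph $G$, let $\lambda(G)$ be its spectral radius, i.e. the maximum modulus of an eigenvalue of the adjacency matrix of $G$. For $r\ge 2$ and $t\ge 2$, let $K_r^+[t]$ be the graph obtained from the complete $r$-partite graph with $t$ vertices in each part by adding one edge inside one of the parts; a graph is $K_r^+[t]$-free if it has no (not necessarily induced) subgraph isomorphic to $K_r^+[t]$. **Theorem.** For all integers $t\ge 2$ and $r\ge 2$ there are $\varepsilon=\varepsilon_{t,r}>0$ and $n_0=n_{t,r}$ such that the following holds. Let $G$ be a $K_r^+[t]$-free graph with $m$ edges, and let $H$ be a complete $r$-partite graph with $V(H)\subseteq V(G)$, each of whose parts has at least $n_0$ vertices, and which is regular if $r\ge 3$. Suppose that $|E(G)\,\triangle\, E(H)|\le \varepsilon m$. Then $$\lambda^2(G)\le \Bigl(1-\frac1r\Bigr)\cdot 2m .$$ Moreover, up to isolated vertices of $G$, equality holds if and only if $G$ is a complete bipartite graph (when $r=2$), respectively a regular complete $r$-partite graph (when $r\ge 3$). -/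

import Mathlib

namespace EdgeSpectral

/-- The spectral radius of a finite graph: the maximum modulus of the eigenvalues of its
adjacency matrix. (The matrix is real symmetric, so all its eigenvalues are real.) -/
noncomputable def lam {V : Type*} [Fintype V] (G : SimpleGraph V) : ℝ :=
  open Classical in (spectralRadius ℝ (G.adjMatrix ℝ)).toReal

/-- The graph `K_r^+[t]`: the complete `r`-partite graph whose parts `{i} × Fin t` all have `t`
vertices, with one edge added between the first two vertices of the first part
(meaningful for `1 ≤ r` and `2 ≤ t`). -/
def blowupPlus (r t : ℕ) : SimpleGraph (Fin r × Fin t) :=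
  SimpleGraph.completeEquipartiteGraph r t ⊔
    SimpleGraph.fromRel fun x y =>
      x.1.val = 0 ∧ y.1.val = 0 ∧ x.2.val = 0 ∧ y.2.val = 1

/-- The complete `r`-partite graph on the (pairwise disjoint) parts `U 0, …, U (r - 1)`, regarded
as a graph on `V` in which all vertices outside the parts are isolated. -/
def completePartite {V : Type*} {r : ℕ} (U : Fin r → Finset V) : SimpleGraph V where
  Adj u v := u ≠ v ∧ ∃ i j, i ≠ j ∧ u ∈ U i ∧ v ∈ U j
  symm := ⟨fun _ _ ⟨h, i, j, hij, hu, hv⟩ => ⟨h.symm, j, i, hij.symm, hv, hu⟩⟩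
  loopless := ⟨fun _ h => h.1 rfl⟩

/-- The graph `H`, viewed as a graph with vertex set `S`, is regular: all vertices in `S` have
the same degree in `H`. -/
def RegularOn {V : Type*} (H : SimpleGraph V) (S : Set V) : Prop :=
  ∃ d : ℕ, ∀ v ∈ S, (H.neighborSet v).ncard = d

/-- The edit distance of two graphs on the same vertex set: the number of edges that have to be
added or deleted to turn one into the other. -/
noncomputable def editDist {V : Type*} (G H : SimpleGraph V) : ℕ :=
  (symmDiff G.edgeSet H.edgeSet).ncard

/-- Up to isolated vertices, `G` is a complete `r`-partite graph (with nonempty parts). -/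
def IsCompletePartite {V : Type*} (r : ℕ) (G : SimpleGraph V) : Prop :=
  ∃ W : Fin r → Finset V, (∀ i, (W i).Nonempty) ∧ Pairwise (Function.onFun Disjoint W) ∧
    G = completePartite W

/-- Up to isolated vertices, `G` is a regular complete `r`-partite graph (with nonempty parts). -/
def IsRegularCompletePartite {V : Type*} (r : ℕ) (G : SimpleGraph V) : Prop :=
  ∃ W : Fin r → Finset V, (∀ i, (W i).Nonempty) ∧ Pairwise (Function.onFun Disjoint W) ∧
    G = completePartite W ∧ RegularOn G (⋃ i, (W i : Set V))

end EdgeSpectral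

/-!
Let `x` be a nonnegative unit vector with `⟨x, A x⟩ ≥ λ(G)`. If `λ(G) ^ 2 ≥ (1 - 1 / r) * 2m`, then,
as `G` is close to the balanced graph `H`, whose adjacency matrix has only one positive eigenvalue,
`x` is close to the Perron vector of `H`. Hence the vertex weights `y = x ^ 2`, of total weight one,
are spread almost evenly over the parts of `H`, and no vertex is heavy.

By the Cauchy–Schwarz inequality over the `2m` ordered edges, `⟨x, A x⟩ ^ 2 ≤ 2m * ⟨y, A y⟩`, so it
remains to show the weighted Turán bound `⟨y, A y⟩ ≤ 1 - 1 / r`. As `G` is `K_r^+[t]`-free, every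
vertex has few neighbours in some part of `H`; recolour it with that part. An edge inside a colour
class then forces one of its ends to miss so much weight in another part that the missing edges
between the classes outweigh the edges inside them.

Equality in both steps makes `x u * x v` constant over the edges and all colour classes equally
heavy, so that `G` is complete `r`-partite, with `x` constant, and parts of equal size, if `r ≥ 3`.
-/

namespace EdgeSpectral

open Finset Matrix

section Mass

variable {V : Type*} [Fintype V] {y : V → ℝ}

/-- The weight `∑ v ∈ s, y v` of a vertex set `s`. The set is a `Set`, so that neighbourhoods and
their Boolean combinations can be weighed without decidability assumptions. -/
noncomputable def mass (y : V → ℝ) (s : Set V) : ℝ :=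
  ∑ v, s.indicator y v

lemma mass_coe (y : V → ℝ) (S : Finset V) : mass y S = ∑ v ∈ S, y v := by
  classical
  simp only [mass, Set.indicator_apply, SetLike.mem_coe, sum_ite_mem, univ_inter]

lemma mass_eq_sum_filter (y : V → ℝ) (s : Set V) [DecidablePred (· ∈ s)] :
    mass y s = ∑ v with v ∈ s, y v := by
  simp only [mass, Set.indicator_apply, sum_filter]

lemma mass_empty (y : V → ℝ) : mass y ∅ = 0 := by
  simp only [mass, Set.indicator_empty, sum_const_zero]

lemma mass_singleton (y : V → ℝ) (v : V) : mass y {v} = y v := by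
  simpa only [coe_singleton, sum_singleton] using mass_coe y {v}

lemma mass_nonneg (hy : ∀ v, 0 ≤ y v) (s : Set V) : 0 ≤ mass y s :=
  sum_nonneg fun v _ => Set.indicator_nonneg (fun w _ => hy w) v

lemma mass_mono (hy : ∀ v, 0 ≤ y v) {s t : Set V} (h : s ⊆ t) : mass y s ≤ mass y t :=
  sum_le_sum fun v _ => Set.indicator_le_indicator_of_subset h hy v

lemma mass_inter_add_diff (y : V → ℝ) (s t : Set V) :
    mass y (s ∩ t) + mass y (s \ t) = mass y s := by
  classical
  rw [mass, mass, mass, ← sum_add_distrib]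
  refine sum_congr rfl fun v _ => ?_
  by_cases hs : v ∈ s <;> by_cases ht : v ∈ t <;> simp [hs, ht]

lemma mass_add_mass_compl (y : V → ℝ) (s : Set V) : mass y s + mass y sᶜ = ∑ v, y v := by
  rw [mass, mass, ← sum_add_distrib]
  exact sum_congr rfl fun v _ => congrFun (Set.indicator_self_add_compl s y) v

lemma mass_union_le (hy : ∀ v, 0 ≤ y v) (s t : Set V) :
    mass y (s ∪ t) ≤ mass y s + mass y t := by
  rw [← mass_inter_add_diff y (s ∪ t) s]
  exact add_le_add (mass_mono hy Set.inter_subset_right)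
    (mass_mono hy fun v hv => hv.1.resolve_left hv.2)

lemma mass_le_add_mass_diff (hy : ∀ v, 0 ≤ y v) (s t : Set V) :
    mass y s ≤ mass y t + mass y (s \ t) := by
  rw [← mass_inter_add_diff y s t]
  gcongr
  exact mass_mono hy Set.inter_subset_right

lemma mass_biUnion_le {ι : Type*} (hy : ∀ v, 0 ≤ y v) (T : Finset ι) (s : ι → Set V) :
    mass y (⋃ b ∈ T, s b) ≤ ∑ b ∈ T, mass y (s b) := by
  classical
  induction T using Finset.induction_on with
  | empty => simp [mass_empty]
  | insert a T ha ih =>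
    rw [set_biUnion_insert, sum_insert ha]
    exact (mass_union_le hy _ _).trans (by gcongr)

lemma mass_coe_biUnion {ι : Type*} [DecidableEq V] (y : V → ℝ) {T : Finset ι} {U : ι → Finset V}
    (hU : (T : Set ι).PairwiseDisjoint U) :
    mass y (T.biUnion U) = ∑ i ∈ T, mass y (U i) := by
  simp only [mass_coe, sum_biUnion hU]

lemma exists_mem_notMem_of_mass_lt (hy : ∀ v, 0 ≤ y v) {s t : Set V} (h : mass y s < mass y t) :
    ∃ v ∈ t, v ∉ s := by
  by_contra! hts
  exact h.not_ge (mass_mono hy hts)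

end Mass

lemma completePartite_adj_iff {V : Type*} {r : ℕ} {U : Fin r → Finset V}
    (hU : Pairwise (Function.onFun Disjoint U)) {i : Fin r} {u v : V} (hu : u ∈ U i) :
    (completePartite U).Adj u v ↔ ∃ j, i ≠ j ∧ v ∈ U j := by
  refine ⟨fun ⟨_, i', j, hij, hu', hv⟩ => ⟨j, ?_, hv⟩, fun ⟨j, hij, hv⟩ => ?_⟩
  · rwa [← hU.eq (not_disjoint_iff.2 ⟨u, hu', hu⟩)]
  · exact ⟨fun h => disjoint_left.1 (hU hij) hu (h ▸ hv), i, j, hij, hu, hv⟩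

section QuadForm

variable {V : Type*} [Fintype V]

open Classical in
/-- The ordered adjacent pairs of `G`; every edge gives two of them. -/
noncomputable def adjPairs (G : SimpleGraph V) : Finset (V × V) :=
  {p | G.Adj p.1 p.2}

lemma mem_adjPairs {G : SimpleGraph V} {p : V × V} : p ∈ adjPairs G ↔ G.Adj p.1 p.2 := by
  simp only [adjPairs, mem_filter, mem_univ, true_and]

lemma card_adjPairs (G : SimpleGraph V) : #(adjPairs G) = 2 * G.edgeSet.ncard := by
  classical
  rw [← SimpleGraph.coe_edgeFinset, Set.ncard_coe_finset, ← G.sum_degrees_eq_twice_card_edges,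
    adjPairs, card_filter, Fintype.sum_prod_type]
  simp only [sum_boole, SimpleGraph.degree, SimpleGraph.neighborFinset_eq_filter, Nat.cast_id]

/-- The quadratic form `⟨x, A x⟩` of the adjacency matrix `A` of `G`. -/
noncomputable def quadForm (G : SimpleGraph V) (x : V → ℝ) : ℝ :=
  ∑ p ∈ adjPairs G, x p.1 * x p.2

lemma quadForm_eq_sum_sum (G : SimpleGraph V) [DecidableRel G.Adj] (x : V → ℝ) :
    quadForm G x = ∑ u, ∑ v, if G.Adj u v then x u * x v else 0 := by
  rw [quadForm, adjPairs, sum_filter, Fintype.sum_prod_type]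
  congr!

lemma sum_adjPairs_mul (G : SimpleGraph V) (a b : V → ℝ) :
    ∑ p ∈ adjPairs G, a p.1 * b p.2 = ∑ u, a u * mass b (G.neighborSet u) := by
  classical
  simp only [adjPairs, sum_filter, Fintype.sum_prod_type, mass_eq_sum_filter,
    SimpleGraph.mem_neighborSet, mul_sum, mul_ite, mul_zero]

lemma sum_adjPairs_swap (G : SimpleGraph V) (f : V × V → ℝ) :
    ∑ p ∈ adjPairs G, f p.swap = ∑ p ∈ adjPairs G, f p :=
  sum_equiv (Equiv.prodComm V V)
    (fun p => mem_adjPairs.trans <| (G.adj_comm _ _).trans (mem_adjPairs (p := p.swap)).symm)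
    fun _ _ => rfl

lemma quadForm_eq_sum_mul_mass (G : SimpleGraph V) (x : V → ℝ) :
    quadForm G x = ∑ u, x u * mass x (G.neighborSet u) :=
  sum_adjPairs_mul G x x

lemma dotProduct_adjMatrix_mulVec (G : SimpleGraph V) [DecidableRel G.Adj] (x : V → ℝ) :
    x ⬝ᵥ (G.adjMatrix ℝ *ᵥ x) = quadForm G x := by
  rw [G.dotProduct_mulVec_adjMatrix, quadForm_eq_sum_sum]

lemma quadForm_nonneg (G : SimpleGraph V) {x : V → ℝ} (hx : ∀ v, 0 ≤ x v) :
    0 ≤ quadForm G x :=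
  sum_nonneg fun _ _ => mul_nonneg (hx _) (hx _)

lemma quadForm_add_quadForm_sdiff (G K : SimpleGraph V) (x : V → ℝ) :
    quadForm G x + quadForm (K \ G) x = quadForm K x + quadForm (G \ K) x := by
  classical
  simp only [quadForm_eq_sum_sum, ← sum_add_distrib]
  refine sum_congr rfl fun u _ => sum_congr rfl fun v _ => ?_
  by_cases hG : G.Adj u v <;> by_cases hK : K.Adj u v <;> simp [hG, hK]

lemma quadForm_one (G : SimpleGraph V) : quadForm G 1 = 2 * G.edgeSet.ncard := by
  simp only [quadForm, Pi.one_apply, mul_one, sum_const, card_adjPairs, nsmul_eq_mul]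
  norm_cast

lemma quadForm_mul (G : SimpleGraph V) {a : V → ℝ} {c : ℝ}
    (ha : ∀ u v, G.Adj u v → a u * a v = c) (x : V → ℝ) :
    quadForm G (fun v => a v * x v) = c * quadForm G x := by
  rw [quadForm, quadForm, mul_sum]
  refine sum_congr rfl fun p hp => ?_
  rw [mul_mul_mul_comm, ha _ _ (mem_adjPairs.1 hp)]

lemma quadForm_top (x : V → ℝ) : quadForm ⊤ x = (∑ v, x v) ^ 2 - ∑ v, x v ^ 2 := by
  simp only [quadForm_eq_sum_mul_mass, SimpleGraph.neighborSet_top]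
  have h (u : V) : mass x {u}ᶜ = ∑ v, x v - x u := by
    rw [← mass_add_mass_compl x {u}, mass_singleton, add_sub_cancel_left]
  simp only [h, mul_sub, sum_sub_distrib, ← sum_mul, sq]

lemma quadForm_completePartite {r : ℕ} {U : Fin r → Finset V}
    (hU : Pairwise (Function.onFun Disjoint U)) (x : V → ℝ) :
    quadForm (completePartite U) x = quadForm ⊤ fun i => mass x (U i) := by
  classical
  have hpairs : adjPairs (completePartite U) =
      (adjPairs (⊤ : SimpleGraph (Fin r))).biUnion fun q => U q.1 ×ˢ U q.2 := by
    ext ⟨u, v⟩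
    simp only [mem_adjPairs, completePartite, mem_biUnion, Prod.exists, SimpleGraph.top_adj,
      mem_product]
    refine ⟨fun ⟨_, i, j, hij, hu, hv⟩ => ⟨i, j, hij, hu, hv⟩, fun ⟨i, j, hij, hu, hv⟩ => ?_⟩
    exact ⟨fun h => disjoint_left.1 (hU hij) hu (h ▸ hv), i, j, hij, hu, hv⟩
  rw [quadForm, hpairs, sum_biUnion]
  · simp only [quadForm, mass_coe, sum_product, sum_mul_sum]
  · intro p _ q _ hpq
    rw [Function.onFun, disjoint_product]
    by_contra! h
    exact hpq (Prod.ext (hU.eq h.1) (hU.eq h.2))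

lemma quadForm_sq_le (G : SimpleGraph V) (x : V → ℝ) :
    quadForm G x ^ 2 ≤ 2 * G.edgeSet.ncard * quadForm G (fun v => x v ^ 2) := by
  have h := sq_sum_le_card_mul_sum_sq (s := adjPairs G) (f := fun p => x p.1 * x p.2)
  simp only [card_adjPairs, mul_pow, Nat.cast_mul, Nat.cast_ofNat] at h
  exact h

lemma eq_of_card_mul_sum_sq_le {ι : Type*} {s : Finset ι} {a : ι → ℝ}
    (h : #s * ∑ i ∈ s, a i ^ 2 ≤ (∑ i ∈ s, a i) ^ 2) {i : ι} (hi : i ∈ s) {j : ι} (hj : j ∈ s) :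
    a i = a j := by
  have hvar : ∑ k ∈ s, (#s * a k - ∑ l ∈ s, a l) ^ 2 ≤ 0 := by
    simp only [sub_sq, mul_pow, sum_add_distrib, sum_sub_distrib, ← mul_sum, ← sum_mul,
      sum_const, nsmul_eq_mul]
    nlinarith [(#s).cast_nonneg (α := ℝ)]
  have hmean {k : ι} (hk : k ∈ s) : #s * a k = ∑ l ∈ s, a l := by
    have h0 := (sum_eq_zero_iff_of_nonneg fun k _ => sq_nonneg _).1
      (hvar.antisymm (sum_nonneg fun k _ => sq_nonneg _)) k hk
    exact sub_eq_zero.1 (sq_eq_zero_iff.1 h0)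
  have hs : (#s : ℝ) ≠ 0 := Nat.cast_ne_zero.2 (card_ne_zero_of_mem hi)
  exact mul_left_cancel₀ hs ((hmean hi).trans (hmean hj).symm)

lemma mul_eq_mul_of_le_quadForm_sq {G : SimpleGraph V} {x : V → ℝ}
    (h : 2 * G.edgeSet.ncard * quadForm G (fun v => x v ^ 2) ≤ quadForm G x ^ 2)
    {u v u' v' : V} (huv : G.Adj u v) (huv' : G.Adj u' v') : x u * x v = x u' * x v' := by
  refine eq_of_card_mul_sum_sq_le (s := adjPairs G) (a := fun p => x p.1 * x p.2) ?_
    (mem_adjPairs (p := (u, v)).2 huv) (mem_adjPairs (p := (u', v')).2 huv')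
  simpa only [quadForm, card_adjPairs, mul_pow, Nat.cast_mul, Nat.cast_ofNat] using h

lemma mul_eq_zero_of_quadForm_nonpos {G : SimpleGraph V} {x : V → ℝ} (hx : ∀ v, 0 ≤ x v)
    (h : quadForm G x ≤ 0) {u v : V} (huv : G.Adj u v) : x u * x v = 0 :=
  (sum_eq_zero_iff_of_nonneg fun _ _ => mul_nonneg (hx _) (hx _)).1
    (h.antisymm (quadForm_nonneg G hx)) (u, v) (mem_adjPairs.2 huv)

lemma quadForm_le_add_two_mul_sum_abs (G : SimpleGraph V) {y w : V → ℝ} (hy : ∀ v, 0 ≤ y v)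
    (hy1 : ∑ v, y v = 1) (hw : ∀ v, 0 ≤ w v) (hw1 : ∑ v, w v = 1) :
    quadForm G y ≤ quadForm G w + 2 * ∑ v, |y v - w v| := by
  have hpair (p : V × V) :
      y p.1 * y p.2 - w p.1 * w p.2 ≤ y p.1 * |y p.2 - w p.2| + |y p.1 - w p.1| * w p.2 := by
    nlinarith [mul_le_mul_of_nonneg_left (le_abs_self (y p.2 - w p.2)) (hy p.1),
      mul_le_mul_of_nonneg_right (le_abs_self (y p.1 - w p.1)) (hw p.2)]
  suffices quadForm G y - quadForm G w ≤ 2 * ∑ v, |y v - w v| by linarith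
  calc quadForm G y - quadForm G w
      = ∑ p ∈ adjPairs G, (y p.1 * y p.2 - w p.1 * w p.2) := (sum_sub_distrib _ _).symm
    _ ≤ ∑ p ∈ adjPairs G, (y p.1 * |y p.2 - w p.2| + |y p.1 - w p.1| * w p.2) :=
        sum_le_sum fun p _ => hpair p
    _ ≤ ∑ p : V × V, (y p.1 * |y p.2 - w p.2| + |y p.1 - w p.1| * w p.2) :=
        sum_le_univ_sum_of_nonneg fun p => add_nonneg (mul_nonneg (hy _) (abs_nonneg _))
          (mul_nonneg (abs_nonneg _) (hw _))
    _ = 2 * ∑ v, |y v - w v| := by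
        simp only [sum_add_distrib, Fintype.sum_prod_type, ← mul_sum, ← sum_mul, hy1, hw1]
        ring

lemma mul_mass_le_quadForm (G : SimpleGraph V) {y : V → ℝ} (hy : ∀ v, 0 ≤ y v) (c : ℝ) :
    c * mass y {u | c ≤ mass y (G.neighborSet u)} ≤ quadForm G y := by
  rw [mass, mul_sum, quadForm_eq_sum_mul_mass]
  refine sum_le_sum fun u _ => ?_
  rw [Set.indicator_apply, mul_ite, mul_zero, mul_comm]
  split_ifs with hu
  · exact mul_le_mul_of_nonneg_left hu (hy u)
  · exact mul_nonneg (hy u) (mass_nonneg hy _)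

lemma quadForm_le_of_cover {G : SimpleGraph V} {y : V → ℝ} (hy : ∀ v, 0 ≤ y v) {B : Set V}
    (hB : ∀ u v, G.Adj u v → u ∈ B ∨ v ∈ B) {D : ℝ} (hD : ∀ u, mass y (G.neighborSet u) ≤ D) :
    quadForm G y ≤ 2 * (D * mass y B) := by
  have hi (v : V) : 0 ≤ B.indicator y v := Set.indicator_nonneg (fun v _ => hy v) v
  have hpair (p : V × V) (hp : p ∈ adjPairs G) :
      y p.1 * y p.2 ≤ B.indicator y p.1 * y p.2 + B.indicator y p.2 * y p.1 := by
    rcases hB _ _ (mem_adjPairs.1 hp) with h | h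
    · rw [Set.indicator_of_mem h]
      exact le_add_of_nonneg_right (mul_nonneg (hi _) (hy _))
    · rw [Set.indicator_of_mem h, mul_comm (y p.2)]
      exact le_add_of_nonneg_left (mul_nonneg (hi _) (hy _))
  calc quadForm G y
      ≤ ∑ p ∈ adjPairs G, (B.indicator y p.1 * y p.2 + B.indicator y p.2 * y p.1) :=
        sum_le_sum hpair
    _ = 2 * ∑ u, B.indicator y u * mass y (G.neighborSet u) := by
        rw [sum_add_distrib, ← sum_adjPairs_mul,
          ← sum_adjPairs_swap G fun p => B.indicator y p.1 * y p.2, two_mul]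
        rfl
    _ ≤ 2 * ∑ u, B.indicator y u * D := by
        gcongr with u
        exacts [hi u, hD u]
    _ = 2 * (D * mass y B) := by rw [← sum_mul, ← mass, mul_comm D]

end QuadForm

section Greedy

variable {V ι : Type*}

/-- The part of a copy of `F` in `G` on the pattern vertices `T`, where the pattern vertex `a` has
to be placed in the candidate set `S a`. -/
structure PartialCopy (F : SimpleGraph ι) (G : SimpleGraph V) (S : ι → Set V) (T : Finset ι)
    (φ : ι → V) : Prop where
  injOn : Set.InjOn φ T
  mem : ∀ a ∈ T, φ a ∈ S a
  adj : ∀ a ∈ T, ∀ b ∈ T, F.Adj a b → G.Adj (φ a) (φ b)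

namespace PartialCopy

variable {F : SimpleGraph ι} {G : SimpleGraph V} {S : ι → Set V} {T : Finset ι} {φ : ι → V}

lemma update [DecidableEq ι] (h : PartialCopy F G S T φ) {a : ι} (ha : a ∉ T) {w : V}
    (hw : w ∈ S a) (hne : ∀ b ∈ T, w ≠ φ b) (hadj : ∀ b ∈ T, F.Adj b a → G.Adj (φ b) w) :
    PartialCopy F G S (insert a T) (Function.update φ a w) := by
  have hφ {b : ι} (hb : b ∈ T) : Function.update φ a w b = φ b :=
    Function.update_of_ne (ne_of_mem_of_not_mem hb ha) w φ
  have hφT : Set.EqOn (Function.update φ a w) φ T := fun b hb => hφ hb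
  refine ⟨?_, ?_, ?_⟩
  · rw [coe_insert, Set.injOn_insert (mem_coe.not.2 ha), hφT.injOn_iff, hφT.image_eq,
      Function.update_self]
    exact ⟨h.injOn, fun ⟨b, hb, hbw⟩ => hne b hb hbw.symm⟩
  · simp only [forall_mem_insert, Function.update_self]
    exact ⟨hw, fun b hb => (hφ hb).symm ▸ h.mem b hb⟩
  · simp only [forall_mem_insert, Function.update_self]
    refine ⟨⟨fun h => (F.irrefl h).elim, fun b hb hF => ?_⟩, fun b hb => ⟨fun hF => ?_, ?_⟩⟩
    · rw [hφ hb]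
      exact (hadj b hb hF.symm).symm
    · rw [hφ hb]
      exact hadj b hb hF
    · intro c hc hF
      rw [hφ hb, hφ hc]
      exact h.adj b hb c hc hF

variable [Fintype V] {y : V → ℝ} {β : ℝ}

/-- Every vertex already placed excludes weight at most `2 * β` from a candidate set: itself and
the non-neighbours. -/
lemma exists_insert [DecidableEq ι] (h : PartialCopy F G S T φ) (hy : ∀ v, 0 ≤ y v)
    (hatom : ∀ v, y v ≤ β) {a : ι} (ha : a ∉ T) (hS : 2 * β * #T < mass y (S a))
    (hmiss : ∀ b ∈ T, F.Adj b a → mass y (S a \ G.neighborSet (φ b)) ≤ β) :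
    ∃ ψ, PartialCopy F G S (insert a T) ψ := by
  classical
  let bad (b : ι) : Set V := {φ b} ∪ {w | w ∈ S a ∧ F.Adj b a ∧ ¬ G.Adj (φ b) w}
  have hbad (b : ι) (hb : b ∈ T) : mass y (bad b) ≤ 2 * β := by
    have hβ : 0 ≤ β := (hy (φ b)).trans (hatom _)
    have hnon : mass y {w | w ∈ S a ∧ F.Adj b a ∧ ¬ G.Adj (φ b) w} ≤ β := by
      by_cases hF : F.Adj b a
      · refine le_trans (mass_mono hy ?_) (hmiss b hb hF)
        exact fun w hw => ⟨hw.1, hw.2.2⟩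
      · simpa only [hF, false_and, and_false, Set.ofPred_false, mass_empty] using hβ
    refine (mass_union_le hy _ _).trans ?_
    rw [mass_singleton, two_mul]
    exact add_le_add (hatom _) hnon
  have hlt : mass y (⋃ b ∈ T, bad b) < mass y (S a) := by
    refine lt_of_le_of_lt ((mass_biUnion_le hy T bad).trans (sum_le_card_nsmul T _ _ hbad)) ?_
    rwa [nsmul_eq_mul, mul_comm]
  obtain ⟨w, hwS, hw⟩ := exists_mem_notMem_of_mass_lt hy hlt
  simp only [Set.mem_iUnion, not_exists] at hw
  refine ⟨_, h.update ha hwS (fun b hb hwb => hw b hb (Or.inl hwb)) fun b hb hF => ?_⟩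
  by_contra hG
  exact hw b hb (Or.inr ⟨hwS, hF, hG⟩)

lemma isContained [Fintype ι] (h : PartialCopy F G S T φ) (hy : ∀ v, 0 ≤ y v) (hβ : 0 ≤ β)
    (hatom : ∀ v, y v ≤ β) (hS : ∀ a ∉ T, 2 * β * Fintype.card ι < mass y (S a))
    (hmiss : ∀ a ∉ T, ∀ b, F.Adj b a → ∀ v ∈ S b, mass y (S a \ G.neighborSet v) ≤ β) :
    F.IsContained G := by
  classical
  suffices ∀ T' : Finset ι, Disjoint T T' → ∃ ψ, PartialCopy F G S (T ∪ T') ψ by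
    obtain ⟨ψ, hψ⟩ := this Tᶜ disjoint_compl_right
    rw [union_compl] at hψ
    exact ⟨⟨⟨ψ, fun {a b} => hψ.adj a (mem_univ a) b (mem_univ b)⟩,
      fun a b => hψ.injOn (mem_univ a) (mem_univ b)⟩⟩
  intro T' hT'
  induction T' using Finset.induction_on with
  | empty => exact ⟨φ, by rwa [union_empty]⟩
  | insert a T' ha ih =>
    obtain ⟨haT, hTT'⟩ := disjoint_insert_right.1 hT'
    obtain ⟨ψ, hψ⟩ := ih hTT'
    rw [union_insert]
    refine hψ.exists_insert hy hatom (notMem_union.2 ⟨haT, ha⟩) (lt_of_le_of_lt ?_ (hS a haT))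
      fun b hb hF => hmiss a haT b hF _ (hψ.mem b hb)
    gcongr
    exact card_le_univ _

end PartialCopy

end Greedy

section Embedding

variable {V : Type*} [Fintype V] {r t : ℕ} {G : SimpleGraph V} {y : V → ℝ} {β : ℝ}

lemma of_blowupPlus_adj_of_fst_eq {a b : Fin r × Fin t} (h : (blowupPlus r t).Adj a b)
    (hab : a.1 = b.1) : (a.1.val = 0 ∧ a.2.val ≤ 1) ∧ b.1.val = 0 ∧ b.2.val ≤ 1 := by
  simp only [blowupPlus, SimpleGraph.sup_adj, SimpleGraph.completeEquipartiteGraph_adj,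
    SimpleGraph.fromRel_adj] at h
  grind

/-- The ends of the additional edge of `K_r^+[t]` go to `u` and `v`, the others are placed greedily.
The parts are permuted so that the additional edge lies in the part belonging to `C i`. -/
lemma blowupPlus_isContained (hy : ∀ v, 0 ≤ y v) (hβ : ∀ v, y v ≤ β) {u v : V} (huv : G.Adj u v)
    {C : Fin r → Set V} (hC : ∀ j, 2 * β * (r * t) < mass y (C j))
    (hmiss : ∀ j k, j ≠ k → ∀ w ∈ C j, mass y (C k \ G.neighborSet w) ≤ β) {i : Fin r}
    (hcommon : ∀ j ≠ i, C j ⊆ G.neighborSet u ∩ G.neighborSet v) :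
    (blowupPlus r t).IsContained G := by
  classical
  let σ : Equiv.Perm (Fin r) := Equiv.swap ⟨0, i.pos⟩ i
  let T : Finset (Fin r × Fin t) := {a | a.1.val = 0 ∧ a.2.val ≤ 1}
  let φ (a : Fin r × Fin t) : V := if a.2.val = 0 then u else v
  let S (a : Fin r × Fin t) : Set V := if a ∈ T then {φ a} else C (σ a.1)
  have hT {a : Fin r × Fin t} : a ∈ T ↔ a.1.val = 0 ∧ a.2.val ≤ 1 := by simp [T]
  have hσ {a b : Fin r × Fin t} (hb : b ∈ T) (hab : a.1 ≠ b.1) : σ a.1 ≠ i := by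
    have hb' : σ b.1 = i := by
      rw [show b.1 = ⟨0, i.pos⟩ from Fin.ext (hT.1 hb).1, Equiv.swap_apply_left]
    exact fun ha => hab (σ.injective (ha.trans hb'.symm))
  have hφ : PartialCopy (blowupPlus r t) G S T φ := by
    refine ⟨fun a ha b hb hab => ?_, fun a ha => by simp [S, ha], fun a ha b hb hF => ?_⟩ <;>
      have ha := hT.1 ha <;> have hb := hT.1 hb
    · have hne := huv.ne
      grind
    · have hne := hF.ne
      have hvu := huv.symm
      grind
  have hβ0 : 0 ≤ β := (hy u).trans (hβ u)
  refine hφ.isContained hy hβ0 hβ (fun a ha => ?_) fun a ha b hba w hw => ?_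
  · simpa [S, ha] using hC (σ a.1)
  have hne : b.1 ≠ a.1 := fun hba' => ha (hT.2 (of_blowupPlus_adj_of_fst_eq hba hba').2)
  simp only [S, ha, if_false] at hw ⊢
  split_ifs at hw with hb
  · have hsub : C (σ a.1) ⊆ G.neighborSet w := by
      refine (hcommon _ (hσ hb hne.symm)).trans ?_
      rw [Set.mem_singleton_iff.1 hw]
      simp only [φ]
      split_ifs
      exacts [Set.inter_subset_left, Set.inter_subset_right]
    rwa [Set.sdiff_eq_empty.2 hsub, mass_empty]
  · exact hmiss _ _ (σ.injective.ne hne) w hw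

end Embedding

section NearPartite

variable {V : Type*} [Fintype V] {r t : ℕ} {G : SimpleGraph V} {y : V → ℝ} {U : Fin r → Finset V}
  {β : ℝ}

/-- `G` with the vertex weights `y` is, up to an error measured by `β`, the complete `r`-partite
graph on `U`: the weights add up to one and are spread evenly over the parts, no single vertex is
heavy, and few of the edges between different parts are missing. -/
structure NearPartite (G : SimpleGraph V) (y : V → ℝ) (U : Fin r → Finset V) (β : ℝ) : Prop where
  pos : 0 < β
  nonneg : ∀ v, 0 ≤ y v
  sum_eq_one : ∑ v, y v = 1
  le_beta : ∀ v, y v ≤ β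
  disjoint : Pairwise (Function.onFun Disjoint U)
  le_mass : ∀ i, 1 / (r : ℝ) - β ^ 2 ≤ mass y (U i)
  quadForm_sdiff_le : quadForm (completePartite U \ G) y ≤ β ^ 2

/-- The weight of the vertices of the other parts that `v` is not adjacent to. -/
noncomputable def missDegree (G : SimpleGraph V) (y : V → ℝ) (U : Fin r → Finset V) (v : V) : ℝ :=
  mass y ((completePartite U \ G).neighborSet v)

lemma mass_diff_neighborSet_le_missDegree (hU : Pairwise (Function.onFun Disjoint U))
    (hy : ∀ v, 0 ≤ y v) {i j : Fin r} (hij : i ≠ j) {v : V} (hv : v ∈ U i) :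
    mass y (U j \ G.neighborSet v) ≤ missDegree G y U v :=
  mass_mono hy fun _ hw => ⟨(completePartite_adj_iff hU hv).2 ⟨j, hij, hw.1⟩, hw.2⟩

namespace NearPartite

lemma mass_le_missDegree_le (h : NearPartite G y U β) :
    mass y {v | β ≤ missDegree G y U v} ≤ β := by
  refine le_of_mul_le_mul_left ?_ h.pos
  calc β * mass y {v | β ≤ missDegree G y U v}
      ≤ quadForm (completePartite U \ G) y := mul_mass_le_quadForm _ h.nonneg β
    _ ≤ β * β := h.quadForm_sdiff_le.trans_eq (sq β)

/-- The candidate sets consist of vertices of small missing degree. -/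
lemma blowupPlus_isContained (h : NearPartite G y U β) {u v : V} (huv : G.Adj u v) {i : Fin r}
    (hi : 2 * β * (r * t) + β < mass y (U i))
    (hcommon : ∀ j ≠ i, 2 * β * (r * t) + β < mass y (U j ∩ (G.neighborSet u ∩ G.neighborSet v))) :
    (blowupPlus r t).IsContained G := by
  classical
  let C (j : Fin r) : Set V :=
    if j = i then U j else U j ∩ (G.neighborSet u ∩ G.neighborSet v)
  have hCU (j : Fin r) : C j ⊆ U j := by
    simp only [C]
    split_ifs
    exacts [subset_rfl, Set.inter_subset_left]
  have hC (j : Fin r) : 2 * β * (r * t) + β < mass y (C j) := by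
    simp only [C]
    split_ifs with hj
    exacts [hj ▸ hi, hcommon j hj]
  let bad : Set V := {w | β ≤ missDegree G y U w}
  refine EdgeSpectral.blowupPlus_isContained (C := fun j => C j \ bad) (i := i) h.nonneg h.le_beta
    huv (fun j => ?_) (fun j k hjk w hw => ?_) fun j hj w hw => ?_
  · linarith [hC j, mass_le_add_mass_diff h.nonneg (C j) bad, h.mass_le_missDegree_le]
  · calc mass y ((C k \ bad) \ G.neighborSet w)
        ≤ mass y (U k \ G.neighborSet w) :=
          mass_mono h.nonneg (Set.sdiff_subset_sdiff_left (Set.sdiff_subset.trans (hCU k)))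
      _ ≤ missDegree G y U w :=
          mass_diff_neighborSet_le_missDegree h.disjoint h.nonneg hjk (hCU j hw.1)
      _ ≤ β := le_of_not_ge hw.2
  · have hwC := hw.1
    simp only [C, if_neg hj] at hwC
    exact hwC.2

end NearPartite

end NearPartite

section Coloring

variable {V : Type*} [Fintype V] {r t : ℕ} {G : SimpleGraph V} {y : V → ℝ} {U : Fin r → Finset V}
  {β : ℝ}

lemma quadForm_comap_top (f : V → Fin r) (x : V → ℝ) :
    quadForm ((⊤ : SimpleGraph (Fin r)).comap f) x =
      quadForm ⊤ fun i => mass x (f ⁻¹' {i}) := by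
  classical
  have hW : Pairwise (Function.onFun Disjoint fun i => ({v | f v = i} : Finset V)) :=
    fun i j hij => disjoint_filter.2 fun v _ hi hj => hij (hi.symm.trans hj)
  have hK : (⊤ : SimpleGraph (Fin r)).comap f =
      completePartite fun i => ({v | f v = i} : Finset V) := by
    ext u v
    rw [completePartite_adj_iff hW (mem_filter.2 ⟨mem_univ u, rfl⟩)]
    simp
  rw [hK, quadForm_completePartite hW]
  congr! with i
  ext v
  simp

/-- For `r` classes, the weighted Turán density is `1 - 1 / r` minus the variance of the class
weights. -/
lemma quadForm_comap_top_add_sum_sq (hr : 0 < r) (f : V → Fin r) (hy1 : ∑ v, y v = 1) :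
    quadForm ((⊤ : SimpleGraph (Fin r)).comap f) y +
      ∑ i, (mass y (f ⁻¹' {i}) - 1 / r) ^ 2 = 1 - 1 / r := by
  classical
  have hsum : ∑ i, mass y (f ⁻¹' {i}) = 1 := by
    rw [← hy1]
    simp only [mass_eq_sum_filter, Set.mem_preimage, Set.mem_singleton_iff]
    exact sum_fiberwise _ _ _
  simp only [quadForm_comap_top, quadForm_top, hsum, sub_sq, sum_add_distrib, sum_sub_distrib,
    ← sum_mul, ← mul_sum, sum_const, card_univ, Fintype.card_fin, nsmul_eq_mul]
  field_simp
  ring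

namespace NearPartite

lemma beta_le_mul (h : NearPartite G y U β) (hr : 0 < r) (ht : 0 < t) : β ≤ r * t * β :=
  le_mul_of_one_le_left h.pos.le (by exact_mod_cast Nat.mul_pos hr ht)

lemma mul_beta_sq_le (h : NearPartite G y U β) (hr : 0 < r) (ht : 0 < t)
    (hβ : 100 * (r * t * β) ≤ 1 / r) : r * β ^ 2 ≤ β := by
  have hrr : r * (1 / r) = (1 : ℝ) := mul_one_div_cancel (Nat.cast_ne_zero.2 hr.ne')
  have hrβ : r * β ≤ 1 := by
    calc r * β ≤ r * (1 / r) := by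
          gcongr
          linarith [h.pos, h.beta_le_mul hr ht]
      _ = 1 := hrr
  calc r * β ^ 2 = r * β * β := by ring
    _ ≤ β := mul_le_of_le_one_left h.pos.le hrβ

lemma beta_sq_le (h : NearPartite G y U β) (hr : 0 < r) (ht : 0 < t)
    (hβ : 100 * (r * t * β) ≤ 1 / r) : β ^ 2 ≤ β :=
  (le_mul_of_one_le_left (sq_nonneg β) (by exact_mod_cast hr)).trans (h.mul_beta_sq_le hr ht hβ)

lemma exists_mass_inter_neighborSet_le (h : NearPartite G y U β) (hr : 0 < r) (ht : 0 < t)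
    (hfree : (blowupPlus r t).Free G) (u : V) :
    ∃ i, mass y (U i ∩ G.neighborSet u) ≤ 4 * (r * t * β) := by
  by_contra! hlarge
  have hβ := h.pos
  have hβτ := h.beta_le_mul hr ht
  let o : Fin r := ⟨0, hr⟩
  obtain ⟨v, ⟨hvo, huv⟩, hv⟩ := exists_mem_notMem_of_mass_lt h.nonneg
    (h.mass_le_missDegree_le.trans_lt (by linarith [hlarge o]) :
      mass y {v | β ≤ missDegree G y U v} < mass y (U o ∩ G.neighborSet u))
  refine hfree (h.blowupPlus_isContained (i := o) huv ?_ fun j hj => ?_)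
  · linarith [hlarge o, mass_mono h.nonneg (Set.inter_subset_left (s := (U o : Set V))
      (t := G.neighborSet u))]
  · have hmiss : mass y (U j \ G.neighborSet v) < β :=
      (mass_diff_neighborSet_le_missDegree h.disjoint h.nonneg hj.symm hvo).trans_lt (not_le.1 hv)
    have hsplit : mass y (U j ∩ G.neighborSet u) ≤
        mass y (U j ∩ (G.neighborSet u ∩ G.neighborSet v)) + mass y (U j \ G.neighborSet v) := by
      refine (mass_mono h.nonneg fun w hw => ?_).trans (mass_union_le h.nonneg _ _)
      by_cases hvw : w ∈ G.neighborSet v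
      exacts [Or.inl ⟨hw.1, hw.2, hvw⟩, Or.inr ⟨hw.1, hvw⟩]
    linarith [hlarge j]

lemma not_adj_of_mass_diff_neighborSet_le (h : NearPartite G y U β)
    (hfree : (blowupPlus r t).Free G) {γ : ℝ} (hγ : 0 ≤ γ)
    (hβγ : 2 * (r * t * β) + β + 2 * γ + β ^ 2 < 1 / r) {i : Fin r} {u v : V}
    (hu : ∀ j ≠ i, mass y (U j \ G.neighborSet u) ≤ γ)
    (hv : ∀ j ≠ i, mass y (U j \ G.neighborSet v) ≤ γ) : ¬ G.Adj u v := by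
  intro huv
  refine hfree (h.blowupPlus_isContained (i := i) huv (by linarith [h.le_mass i]) fun j hj => ?_)
  have hsplit : mass y (U j) ≤ mass y (U j ∩ (G.neighborSet u ∩ G.neighborSet v)) +
      (mass y (U j \ G.neighborSet u) + mass y (U j \ G.neighborSet v)) := by
    rw [← mass_inter_add_diff y _ (G.neighborSet u ∩ G.neighborSet v), Set.sdiff_inter]
    gcongr
    exact mass_union_le h.nonneg _ _
  linarith [hu j hj, hv j hj, h.le_mass j]

lemma mass_compl_parts_le (h : NearPartite G y U β) (hr : 0 < r) :
    mass y (⋃ i, (U i : Set V))ᶜ ≤ r * β ^ 2 := by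
  classical
  have hparts : mass y (⋃ i, (U i : Set V)) = ∑ i, mass y (U i) := by
    rw [← mass_coe_biUnion y (h.disjoint.set_pairwise _), coe_biUnion]
    simp
  have hsum : ∑ _i : Fin r, (1 / (r : ℝ) - β ^ 2) ≤ ∑ i, mass y (U i) :=
    sum_le_sum fun i _ => h.le_mass i
  have hr' : (r : ℝ) * (1 / r) = 1 := mul_one_div_cancel (by positivity)
  rw [sum_const, card_univ, Fintype.card_fin, nsmul_eq_mul, mul_sub, hr'] at hsum
  linarith [mass_add_mass_compl y (⋃ i, (U i : Set V)), h.sum_eq_one]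

variable {f : V → Fin r}

lemma eq_of_mem_of_missDegree_lt (h : NearPartite G y U β) (hr : 0 < r) (ht : 0 < t)
    (hβ : 100 * (r * t * β) ≤ 1 / r)
    (hf : ∀ u, mass y (U (f u) ∩ G.neighborSet u) ≤ 4 * (r * t * β)) {j : Fin r} {u : V}
    (hu : u ∈ U j) (hmiss : missDegree G y U u < β) : f u = j := by
  by_contra hne
  have hβ2 := h.beta_sq_le hr ht hβ
  linarith [h.pos, h.beta_le_mul hr ht, hf u, h.le_mass (f u),
    mass_inter_add_diff y (U (f u)) (G.neighborSet u),
    mass_diff_neighborSet_le_missDegree (G := G) h.disjoint h.nonneg (Ne.symm hne) hu]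

lemma mass_notMem_coloring_le (h : NearPartite G y U β) (hr : 0 < r) (ht : 0 < t)
    (hβ : 100 * (r * t * β) ≤ 1 / r)
    (hf : ∀ u, mass y (U (f u) ∩ G.neighborSet u) ≤ 4 * (r * t * β)) :
    mass y {v | v ∉ U (f v)} ≤ 2 * β := by
  have hsub : {v | v ∉ U (f v)} ⊆ {v | β ≤ missDegree G y U v} ∪ (⋃ i, (U i : Set V))ᶜ := by
    intro v hv
    by_contra hvgood
    simp only [Set.mem_union, Set.mem_ofPred_eq, Set.mem_compl_iff, Set.mem_iUnion, mem_coe,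
      not_or, not_le, not_not] at hvgood
    obtain ⟨hmiss, j, hj⟩ := hvgood
    exact hv (h.eq_of_mem_of_missDegree_lt hr ht hβ hf hj hmiss ▸ hj)
  linarith [mass_mono h.nonneg hsub, mass_union_le h.nonneg {v | β ≤ missDegree G y U v}
    (⋃ i, (U i : Set V))ᶜ, h.mass_le_missDegree_le, h.mass_compl_parts_le hr,
    h.mul_beta_sq_le hr ht hβ]

lemma mass_neighborSet_sdiff_comap_le (h : NearPartite G y U β) (hr : 0 < r) (ht : 0 < t)
    (hβ : 100 * (r * t * β) ≤ 1 / r)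
    (hf : ∀ u, mass y (U (f u) ∩ G.neighborSet u) ≤ 4 * (r * t * β)) (u : V) :
    mass y ((G \ (⊤ : SimpleGraph (Fin r)).comap f).neighborSet u) ≤ 6 * (r * t * β) := by
  have hsub : (G \ (⊤ : SimpleGraph (Fin r)).comap f).neighborSet u ⊆
      (U (f u) ∩ G.neighborSet u) ∪ {v | v ∉ U (f v)} := by
    rintro v ⟨huv, hfv⟩
    have hfv : f u = f v := by simpa using hfv
    by_cases hv : v ∈ U (f v)
    exacts [Or.inl ⟨hfv ▸ hv, huv⟩, Or.inr hv]
  linarith [mass_mono h.nonneg hsub, mass_union_le h.nonneg (U (f u) ∩ G.neighborSet u)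
    {v | v ∉ U (f v)}, hf u, h.mass_notMem_coloring_le hr ht hβ hf, h.beta_le_mul hr ht]

lemma mass_diff_neighborSet_le_mass_sdiff (h : NearPartite G y U β) (hr : 0 < r) (ht : 0 < t)
    (hβ : 100 * (r * t * β) ≤ 1 / r)
    (hf : ∀ u, mass y (U (f u) ∩ G.neighborSet u) ≤ 4 * (r * t * β)) (u : V) {j : Fin r}
    (hj : j ≠ f u) : mass y (U j \ G.neighborSet u) ≤
      mass y (((⊤ : SimpleGraph (Fin r)).comap f \ G).neighborSet u) + 2 * β := by
  have hsub : (U j : Set V) \ G.neighborSet u ⊆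
      ((⊤ : SimpleGraph (Fin r)).comap f \ G).neighborSet u ∪ {v | v ∉ U (f v)} := by
    rintro v ⟨hvj, huv⟩
    by_cases hv : v ∈ U (f v)
    · have hfv : f v = j := h.disjoint.eq (not_disjoint_iff.2 ⟨v, hv, hvj⟩)
      exact Or.inl ⟨fun hfu => hj (hfv ▸ hfu.symm), huv⟩
    · exact Or.inr hv
  linarith [mass_mono h.nonneg hsub, h.mass_notMem_coloring_le hr ht hβ hf, mass_union_le h.nonneg
    (((⊤ : SimpleGraph (Fin r)).comap f \ G).neighborSet u) {v | v ∉ U (f v)}]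

/-- Every edge inside a class has an end that misses much of the other classes; by Markov's
inequality few vertices do. -/
lemma two_mul_quadForm_sdiff_comap_le (h : NearPartite G y U β) (hr : 0 < r) (ht : 0 < t)
    (hβ : 100 * (r * t * β) ≤ 1 / r) (hfree : (blowupPlus r t).Free G)
    (hf : ∀ u, mass y (U (f u) ∩ G.neighborSet u) ≤ 4 * (r * t * β)) :
    2 * quadForm (G \ (⊤ : SimpleGraph (Fin r)).comap f) y ≤
      quadForm ((⊤ : SimpleGraph (Fin r)).comap f \ G) y := by
  set K := (⊤ : SimpleGraph (Fin r)).comap f with hK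
  have hβτ := h.beta_le_mul hr ht
  have hβ2 := h.beta_sq_le hr ht hβ
  have hcover (u v : V) (huv : (G \ K).Adj u v) :
      24 * (r * t * β) ≤ mass y ((K \ G).neighborSet u) ∨
        24 * (r * t * β) ≤ mass y ((K \ G).neighborSet v) := by
    by_contra! hlt
    have hfuv : f u = f v := by simpa [hK] using huv.2
    refine h.not_adj_of_mass_diff_neighborSet_le (i := f u) (u := u) (v := v)
      (γ := 24 * (r * t * β) + 2 * β) hfree (by linarith [h.pos]) (by linarith [h.pos])
      (fun j hj => ?_) (fun j hj => ?_) huv.1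
    · linarith [h.mass_diff_neighborSet_le_mass_sdiff hr ht hβ hf u hj]
    · linarith [h.mass_diff_neighborSet_le_mass_sdiff hr ht hβ hf v (hfuv ▸ hj)]
  have hG := quadForm_le_of_cover h.nonneg
    (B := {u | 24 * (r * t * β) ≤ mass y ((K \ G).neighborSet u)}) hcover
    (h.mass_neighborSet_sdiff_comap_le hr ht hβ hf)
  have hK' := mul_mass_le_quadForm (K \ G) h.nonneg (24 * (r * t * β))
  linarith

lemma exists_coloring_quadForm_le (h : NearPartite G y U β) (hr : 0 < r) (ht : 0 < t)
    (hβ : 100 * (r * t * β) ≤ 1 / r) (hfree : (blowupPlus r t).Free G) :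
    ∃ f : V → Fin r,
      2 * quadForm (G \ (⊤ : SimpleGraph (Fin r)).comap f) y ≤
        quadForm ((⊤ : SimpleGraph (Fin r)).comap f \ G) y ∧
      quadForm G y + ∑ i, (mass y (f ⁻¹' {i}) - 1 / r) ^ 2 +
        quadForm ((⊤ : SimpleGraph (Fin r)).comap f \ G) y / 2 ≤ 1 - 1 / r := by
  choose f hf using h.exists_mass_inter_neighborSet_le hr ht hfree
  have hle := h.two_mul_quadForm_sdiff_comap_le hr ht hβ hfree hf
  refine ⟨f, hle, ?_⟩
  linarith [quadForm_add_quadForm_sdiff G ((⊤ : SimpleGraph (Fin r)).comap f) y,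
    quadForm_comap_top_add_sum_sq hr f h.sum_eq_one]

lemma quadForm_le (h : NearPartite G y U β) (hr : 0 < r) (ht : 0 < t)
    (hβ : 100 * (r * t * β) ≤ 1 / r) (hfree : (blowupPlus r t).Free G) :
    quadForm G y ≤ 1 - 1 / r := by
  obtain ⟨f, -, hle⟩ := h.exists_coloring_quadForm_le hr ht hβ hfree
  linarith [quadForm_nonneg ((⊤ : SimpleGraph (Fin r)).comap f \ G) h.nonneg,
    sum_nonneg fun i (_ : i ∈ univ) => sq_nonneg (mass y (f ⁻¹' {i}) - 1 / r)]

lemma exists_coloring_of_le_quadForm (h : NearPartite G y U β) (hr : 0 < r) (ht : 0 < t)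
    (hβ : 100 * (r * t * β) ≤ 1 / r) (hfree : (blowupPlus r t).Free G)
    (hge : 1 - 1 / r ≤ quadForm G y) :
    ∃ f : V → Fin r, (∀ i, mass y (f ⁻¹' {i}) = 1 / r) ∧
      ∀ u v, 0 < y u → 0 < y v → (G.Adj u v ↔ f u ≠ f v) := by
  obtain ⟨f, hGK, hle⟩ := h.exists_coloring_quadForm_le hr ht hβ hfree
  set K := (⊤ : SimpleGraph (Fin r)).comap f
  have hvar := sum_nonneg fun i (_ : i ∈ univ) => sq_nonneg (mass y (f ⁻¹' {i}) - 1 / r)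
  have hKG := quadForm_nonneg (K \ G) h.nonneg
  refine ⟨f, fun i => ?_, fun u v hu hv => ?_⟩
  · have hi := (sum_eq_zero_iff_of_nonneg fun i _ => sq_nonneg _).1
      (hvar.antisymm' (by linarith)) i (mem_univ i)
    exact sub_eq_zero.1 (sq_eq_zero_iff.1 hi)
  · have huv : y u * y v ≠ 0 := (mul_pos hu hv).ne'
    refine ⟨fun hG hf => huv ?_, fun hf => ?_⟩
    · exact mul_eq_zero_of_quadForm_nonpos (G := G \ K) h.nonneg (by linarith)
        ⟨hG, fun hadj => hadj hf⟩
    · by_contra hG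
      exact huv (mul_eq_zero_of_quadForm_nonpos (G := K \ G) h.nonneg (by linarith) ⟨hf, hG⟩)

end NearPartite

end Coloring

section Lam

lemma isHermitian_adjMatrix {V : Type*} (G : SimpleGraph V) [DecidableRel G.Adj] :
    (G.adjMatrix ℝ).IsHermitian :=
  (conjTranspose_eq_transpose_of_trivial _).trans G.isSymm_adjMatrix

variable {V : Type*} [Fintype V]

lemma lam_nonneg (G : SimpleGraph V) : 0 ≤ lam G := ENNReal.toReal_nonneg

lemma isGreatest_lam [Nonempty V] [DecidableEq V] (G : SimpleGraph V) [DecidableRel G.Adj] :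
    IsGreatest (Set.range fun j => |(isHermitian_adjMatrix G).eigenvalues j|) (lam G) := by
  have hA := isHermitian_adjMatrix G
  obtain ⟨j, hj⟩ := Finite.exists_max fun j => |hA.eigenvalues j|
  suffices lam G = |hA.eigenvalues j| from this ▸ ⟨⟨j, rfl⟩, Set.forall_mem_range.2 hj⟩
  have hsup : spectralRadius ℝ (G.adjMatrix ℝ) = ‖hA.eigenvalues j‖₊ := by
    rw [spectralRadius, hA.spectrum_real_eq_range_eigenvalues, iSup_range]
    refine (iSup_le fun i => ?_).antisymm (le_iSup (fun i => (‖hA.eigenvalues i‖₊ : ENNReal)) j)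
    exact ENNReal.coe_le_coe.2 (hj i)
  calc lam G = (spectralRadius ℝ (G.adjMatrix ℝ)).toReal := by rw [lam]; congr!
    _ = |hA.eigenvalues j| := by rw [hsup, ENNReal.coe_toReal, coe_nnnorm, Real.norm_eq_abs]

lemma quadForm_le_lam [Nonempty V] (G : SimpleGraph V) {x : V → ℝ} (hx : ∑ v, x v ^ 2 = 1) :
    quadForm G x ≤ lam G := by
  classical
  have hA := isHermitian_adjMatrix G
  have hpsd : (algebraMap ℝ (Matrix V V ℝ) (lam G) - G.adjMatrix ℝ).PosSemidef := by
    refine posSemidef_iff_isHermitian_and_spectrum_nonneg.2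
      ⟨(isHermitian_diagonal _).sub hA, ?_⟩
    rw [← spectrum.singleton_sub_eq, hA.spectrum_real_eq_range_eigenvalues, Set.singleton_sub]
    rintro _ ⟨_, ⟨i, rfl⟩, rfl⟩
    exact sub_nonneg.2 ((le_abs_self _).trans ((isGreatest_lam G).2 ⟨i, rfl⟩))
  have hx' : x ⬝ᵥ x = 1 := by simpa only [dotProduct, ← sq] using hx
  have hnonneg := hpsd.dotProduct_mulVec_nonneg x
  rw [star_trivial, sub_mulVec, Algebra.algebraMap_eq_smul_one, smul_mulVec, one_mulVec,
    dotProduct_sub, dotProduct_smul, hx', smul_eq_mul, mul_one,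
    dotProduct_adjMatrix_mulVec] at hnonneg
  exact sub_nonneg.1 hnonneg

lemma exists_unit_vector_lam_le [Nonempty V] (G : SimpleGraph V) :
    ∃ x : V → ℝ, (∀ v, 0 ≤ x v) ∧ ∑ v, x v ^ 2 = 1 ∧ lam G ≤ quadForm G x := by
  classical
  obtain ⟨⟨j, hj⟩, -⟩ := isGreatest_lam G
  have hA := isHermitian_adjMatrix G
  set w : V → ℝ := (hA.eigenvectorBasis j).ofLp with hw
  have hw1 : ∑ v, w v ^ 2 = 1 := by
    rw [hw, ← EuclideanSpace.real_norm_sq_eq, OrthonormalBasis.norm_eq_one, one_pow]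
  have hquad : quadForm G w = hA.eigenvalues j := by
    rw [← dotProduct_adjMatrix_mulVec, hA.mulVec_eigenvectorBasis, dotProduct_smul, ← hw]
    simp only [dotProduct, ← sq, hw1, smul_eq_mul, mul_one]
  refine ⟨fun v => |w v|, fun v => abs_nonneg _, by simpa only [sq_abs] using hw1, ?_⟩
  calc lam G = |quadForm G w| := by rw [hquad]; exact hj.symm
    _ ≤ quadForm G fun v => |w v| :=
        (abs_sum_le_sum_abs _ _).trans_eq (sum_congr rfl fun p _ => abs_mul _ _)

end Lam

section Balanced

variable {V : Type*} {r : ℕ} {U : Fin r → Finset V} {s : ℝ}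

/-- Disjoint nonempty parts for which the geometric mean of the sizes of two distinct parts is
always `s`. This covers two arbitrary parts as well as parts of equal sizes. -/
structure IsBalanced (U : Fin r → Finset V) (s : ℝ) : Prop where
  disjoint : Pairwise (Function.onFun Disjoint U)
  nonempty : ∀ i, (U i).Nonempty
  sqrt_mul_sqrt : ∀ i j, i ≠ j → √(#(U i)) * √(#(U j)) = s

namespace IsBalanced

lemma card_pos (h : IsBalanced U s) (i : Fin r) : (0 : ℝ) < #(U i) :=
  Nat.cast_pos.2 (h.nonempty i).card_pos

lemma sqrt_card_pos (h : IsBalanced U s) (i : Fin r) : 0 < √(#(U i) : ℝ) :=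
  Real.sqrt_pos.2 (h.card_pos i)

lemma card_mul_card (h : IsBalanced U s) {i j : Fin r} (hij : i ≠ j) :
    (#(U i) : ℝ) * #(U j) = s ^ 2 := by
  rw [← h.sqrt_mul_sqrt i j hij, mul_pow, Real.sq_sqrt (h.card_pos i).le,
    Real.sq_sqrt (h.card_pos j).le]

lemma pos (h : IsBalanced U s) (hr : 2 ≤ r) : 0 < s := by
  rw [← h.sqrt_mul_sqrt ⟨0, by lia⟩ ⟨1, by lia⟩ (by simp)]
  exact mul_pos (h.sqrt_card_pos _) (h.sqrt_card_pos _)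

end IsBalanced

lemma ncard_neighborSet_completePartite (hU : Pairwise (Function.onFun Disjoint U)) {v : V}
    {i : Fin r} (hv : v ∈ U i) :
    ((completePartite U).neighborSet v).ncard + #(U i) = ∑ j, #(U j) := by
  classical
  have hset : (completePartite U).neighborSet v = (univ.erase i).biUnion U := by
    ext w
    simp [completePartite_adj_iff hU hv, eq_comm]
  rw [hset, Set.ncard_coe_finset, card_biUnion fun _ _ _ _ h => hU h,
    sum_erase_add _ _ (mem_univ i)]

lemma card_eq_card_of_regularOn (hU : Pairwise (Function.onFun Disjoint U))
    (hne : ∀ i, (U i).Nonempty) (hreg : RegularOn (completePartite U) (⋃ i, (U i : Set V)))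
    (i j : Fin r) : #(U i) = #(U j) := by
  obtain ⟨d, hd⟩ := hreg
  have hcard (k : Fin r) : d + #(U k) = ∑ l, #(U l) := by
    obtain ⟨v, hv⟩ := hne k
    rw [← ncard_neighborSet_completePartite hU hv, hd v (Set.mem_iUnion.2 ⟨k, hv⟩)]
  exact Nat.add_left_cancel ((hcard i).trans (hcard j).symm)

lemma regularOn_completePartite (hU : Pairwise (Function.onFun Disjoint U)) {k : ℕ}
    (hcard : ∀ i, #(U i) = k) : RegularOn (completePartite U) (⋃ i, (U i : Set V)) := by
  refine ⟨∑ j, #(U j) - k, fun v hv => ?_⟩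
  obtain ⟨i, hi⟩ := Set.mem_iUnion.1 hv
  rw [← ncard_neighborSet_completePartite hU (mem_coe.1 hi), hcard i, Nat.add_sub_cancel]

lemma exists_isBalanced (hr : 2 ≤ r) (hU : Pairwise (Function.onFun Disjoint U))
    (hne : ∀ i, (U i).Nonempty)
    (hreg : 3 ≤ r → RegularOn (completePartite U) (⋃ i, (U i : Set V))) :
    ∃ s, IsBalanced U s := by
  suffices ∃ s, ∀ i j, i ≠ j → √(#(U i)) * √(#(U j)) = s from
    this.imp fun s hs => ⟨hU, hne, hs⟩
  obtain rfl | h3 := hr.eq_or_lt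
  · refine ⟨√(#(U 0)) * √(#(U 1)), fun i j hij => ?_⟩
    fin_cases i <;> fin_cases j <;> simp_all [mul_comm]
  · have hcard := card_eq_card_of_regularOn hU hne (hreg h3)
    exact ⟨√(#(U ⟨0, by lia⟩)) * √(#(U ⟨0, by lia⟩)), fun i j _ => by rw [hcard i, hcard j]⟩

lemma IsBalanced.two_mul_ncard_edgeSet [Finite V] (h : IsBalanced U s) :
    2 * ((completePartite U).edgeSet.ncard : ℝ) = r * (r - 1) * s ^ 2 := by
  have := Fintype.ofFinite V
  have hmass : (fun i => mass (1 : V → ℝ) (U i)) = fun i => (#(U i) : ℝ) * 1 := by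
    simp only [mass_coe, Pi.one_apply, sum_const, nsmul_eq_mul]
  rw [← quadForm_one, quadForm_completePartite h.disjoint, hmass,
    quadForm_mul ⊤ fun i j hij => h.card_mul_card hij, quadForm_top]
  simp only [sum_const, card_univ, Fintype.card_fin, nsmul_eq_mul]
  ring

lemma IsBalanced.mul_two_mul_ncard_edgeSet [Finite V] (h : IsBalanced U s) (hr : 0 < r) :
    (1 - 1 / r) * (2 * ((completePartite U).edgeSet.ncard : ℝ)) = ((r - 1) * s) ^ 2 := by
  have hr' : (r : ℝ) ≠ 0 := Nat.cast_ne_zero.2 hr.ne'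
  rw [h.two_mul_ncard_edgeSet]
  field_simp

/-- The normalised Perron vector of `completePartite U` for balanced parts `U`: it spreads the
squared weight `1 / r` uniformly over every part. -/
noncomputable def partVector (U : Fin r → Finset V) (u : V) : ℝ :=
  ∑ i, (U i : Set V).indicator (fun _ => 1 / (√r * √(#(U i)))) u

lemma partVector_nonneg (U : Fin r → Finset V) (u : V) : 0 ≤ partVector U u :=
  sum_nonneg fun _ _ => Set.indicator_nonneg (fun _ _ => by positivity) u

lemma partVector_of_mem (hU : Pairwise (Function.onFun Disjoint U)) {u : V} {i : Fin r}
    (hu : u ∈ U i) : partVector U u = 1 / (√r * √(#(U i))) := by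
  rw [partVector, sum_eq_single_of_mem i (mem_univ i), Set.indicator_of_mem (mem_coe.2 hu)]
  exact fun j _ hj => Set.indicator_of_notMem (disjoint_left.1 (hU hj.symm) hu) _

lemma partVector_sq_of_mem (hU : Pairwise (Function.onFun Disjoint U)) {u : V} {i : Fin r}
    (hu : u ∈ U i) : partVector U u ^ 2 = 1 / (r * #(U i)) := by
  rw [partVector_of_mem hU hu, div_pow, mul_pow, one_pow, Real.sq_sqrt (Nat.cast_nonneg _),
    Real.sq_sqrt (Nat.cast_nonneg _)]

lemma partVector_of_notMem {u : V} (hu : ∀ i, u ∉ U i) : partVector U u = 0 :=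
  sum_eq_zero fun i _ => Set.indicator_of_notMem (hu i) _

lemma IsBalanced.partVector_sq_mul_partVector_sq (h : IsBalanced U s) {u v : V}
    (huv : (completePartite U).Adj u v) :
    partVector U u ^ 2 * partVector U v ^ 2 = 1 / (r * s) ^ 2 := by
  obtain ⟨-, i, j, hij, hu, hv⟩ := huv
  rw [partVector_sq_of_mem h.disjoint hu, partVector_sq_of_mem h.disjoint hv, mul_pow,
    ← h.card_mul_card hij]
  field_simp

lemma IsBalanced.partVector_sq_le (h : IsBalanced U s) (hr : 2 ≤ r) {β : ℝ} (hβ : 0 < β)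
    (hcard : ∀ i, 2 / β ≤ #(U i)) (v : V) : partVector U v ^ 2 ≤ β / 4 := by
  have hr' : (2 : ℝ) ≤ r := Nat.ofNat_le_cast.2 hr
  by_cases hv : ∃ i, v ∈ U i
  · obtain ⟨i, hi⟩ := hv
    calc partVector U v ^ 2 = 1 / (r * #(U i)) := partVector_sq_of_mem h.disjoint hi
      _ ≤ 1 / (2 * (2 / β)) := by
          gcongr
          exact hcard i
      _ = β / 4 := by
          field_simp
          norm_num
  · rw [partVector_of_notMem (not_exists.1 hv), zero_pow two_ne_zero]
    positivity

variable [Fintype V]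

lemma sum_partVector_mul (U : Fin r → Finset V) (x : V → ℝ) :
    ∑ u, partVector U u * x u = (∑ i, mass x (U i) / √(#(U i))) / √r := by
  simp only [partVector, sum_mul, mass, sum_div]
  rw [sum_comm]
  refine sum_congr rfl fun i _ => sum_congr rfl fun u _ => ?_
  by_cases hu : u ∈ (U i : Set V)
  · rw [Set.indicator_of_mem hu, Set.indicator_of_mem hu]
    ring
  · simp only [Set.indicator_of_notMem hu, zero_mul, zero_div]

namespace IsBalanced

lemma mass_partVector (h : IsBalanced U s) (i : Fin r) :
    mass (partVector U) (U i) / √(#(U i)) = 1 / √r := by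
  rw [mass_coe, sum_congr rfl fun u hu => partVector_of_mem h.disjoint hu, sum_const, nsmul_eq_mul,
    mul_one_div, div_div, mul_assoc, Real.mul_self_sqrt (h.card_pos i).le,
    div_mul_cancel_right₀ (h.card_pos i).ne', one_div]

lemma mass_partVector_sq (h : IsBalanced U s) (i : Fin r) :
    mass (fun u => partVector U u ^ 2) (U i) = 1 / r := by
  have hi := (h.card_pos i).ne'
  rw [mass_coe, sum_congr rfl fun u hu => partVector_sq_of_mem h.disjoint hu, sum_const,
    nsmul_eq_mul, mul_one_div, mul_comm (r : ℝ), div_mul_cancel_left₀ hi, one_div]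

lemma sum_partVector_sq (h : IsBalanced U s) (hr : 0 < r) : ∑ u, partVector U u ^ 2 = 1 := by
  have hr' : (0 : ℝ) < r := Nat.cast_pos.2 hr
  simp only [sq, sum_partVector_mul, h.mass_partVector, sum_const, card_univ, Fintype.card_fin,
    nsmul_eq_mul, mul_one_div, div_div, Real.mul_self_sqrt hr'.le, div_self hr'.ne']

lemma quadForm_eq (h : IsBalanced U s) (x : V → ℝ) :
    quadForm (completePartite U) x = s * quadForm ⊤ fun i => mass x (U i) / √(#(U i)) := by
  rw [quadForm_completePartite h.disjoint, ← quadForm_mul ⊤ h.sqrt_mul_sqrt]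
  congr! 2 with i
  exact (mul_div_cancel₀ _ (h.sqrt_card_pos i).ne').symm

lemma quadForm_partVector (h : IsBalanced U s) (hr : 0 < r) :
    quadForm (completePartite U) (partVector U) = (r - 1) * s := by
  have hr' : (r : ℝ) ≠ 0 := Nat.cast_ne_zero.2 hr.ne'
  simp only [h.quadForm_eq, h.mass_partVector, quadForm_top, sum_const, card_univ,
    Fintype.card_fin, nsmul_eq_mul, mul_pow, div_pow, one_pow, Real.sq_sqrt (Nat.cast_nonneg r)]
  field_simp

/-- The spectral gap of a balanced complete `r`-partite graph: apart from the Perron vector its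
adjacency matrix has no positive eigenvalues. -/
lemma quadForm_le_mul_inner_sq (h : IsBalanced U s) (hr : 2 ≤ r) (x : V → ℝ) :
    quadForm (completePartite U) x ≤ (r - 1) * s * (∑ u, partVector U u * x u) ^ 2 := by
  have hr' : (0 : ℝ) < r := Nat.cast_pos.2 (by lia)
  have hs := h.pos hr
  set ξ : Fin r → ℝ := fun i => mass x (U i) / √(#(U i))
  have hinner : (∑ u, partVector U u * x u) ^ 2 = (∑ i, ξ i) ^ 2 / r := by
    rw [sum_partVector_mul, div_pow, Real.sq_sqrt hr'.le]
  have hcs : (∑ i, ξ i) ^ 2 ≤ r * ∑ i, ξ i ^ 2 := by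
    simpa using sq_sum_le_card_mul_sum_sq (s := univ) (f := ξ)
  calc quadForm (completePartite U) x
      = s * ((∑ i, ξ i) ^ 2 - ∑ i, ξ i ^ 2) := by rw [h.quadForm_eq, quadForm_top]
    _ ≤ s * ((∑ i, ξ i) ^ 2 - (∑ i, ξ i) ^ 2 / r) := by
        gcongr
        exact (div_le_iff₀' hr').2 hcs
    _ = (r - 1) * s * (∑ u, partVector U u * x u) ^ 2 := by
        rw [hinner]
        field_simp

lemma le_lam_sq (h : IsBalanced U s) (hr : 2 ≤ r) :
    (1 - 1 / (r : ℝ)) * (2 * (completePartite U).edgeSet.ncard) ≤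
      lam (completePartite U) ^ 2 := by
  have hr' : (2 : ℝ) ≤ r := Nat.ofNat_le_cast.2 hr
  have : Nonempty V := ⟨(h.nonempty ⟨0, by lia⟩).choose⟩
  have hle : (r - 1) * s ≤ lam (completePartite U) :=
    h.quadForm_partVector (by lia) ▸ quadForm_le_lam _ (h.sum_partVector_sq (by lia))
  rw [h.mul_two_mul_ncard_edgeSet (by lia)]
  exact pow_le_pow_left₀ (mul_nonneg (by linarith) (h.pos hr).le) hle 2

end IsBalanced

lemma le_lam_sq_completePartite (hr : 2 ≤ r) {W : Fin r → Finset V}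
    (hW : Pairwise (Function.onFun Disjoint W)) (hne : ∀ i, (W i).Nonempty)
    (hreg : 3 ≤ r → RegularOn (completePartite W) (⋃ i, (W i : Set V))) :
    (1 - 1 / (r : ℝ)) * (2 * (completePartite W).edgeSet.ncard) ≤ lam (completePartite W) ^ 2 := by
  obtain ⟨s, hs⟩ := exists_isBalanced hr hW hne hreg
  exact hs.le_lam_sq hr

end Balanced

section EditDist

variable {V : Type*}

lemma editDist_comm (G K : SimpleGraph V) : editDist G K = editDist K G := by
  rw [editDist, editDist, symmDiff_comm]

variable [Finite V]

lemma ncard_edgeSet_sdiff_le_of_editDist_le {G K : SimpleGraph V} {c : ℝ}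
    (h : editDist G K ≤ c) : (G \ K).edgeSet.ncard ≤ c := by
  refine (Nat.cast_le.2 ?_).trans h
  rw [editDist, SimpleGraph.edgeSet_sdiff]
  exact Set.ncard_le_ncard le_sup_left

lemma ncard_edgeSet_le_add_of_editDist_le {G K : SimpleGraph V} {c : ℝ}
    (h : editDist G K ≤ c) : K.edgeSet.ncard ≤ G.edgeSet.ncard + c := by
  have hsub : K.edgeSet ⊆ G.edgeSet ∪ symmDiff G.edgeSet K.edgeSet :=
    Set.sdiff_subset_iff.1 le_sup_right
  have hcard : K.edgeSet.ncard ≤ G.edgeSet.ncard + editDist G K :=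
    (Set.ncard_le_ncard hsub).trans (Set.ncard_union_le _ _)
  exact (Nat.cast_le.2 hcard).trans (by push_cast; gcongr)

variable {r : ℕ} {U : Fin r → Finset V} {s κ : ℝ} {G : SimpleGraph V}

namespace IsBalanced

lemma ncard_edgeSet_pos_of_editDist_le (h : IsBalanced U s) (hr : 2 ≤ r)
    (hedit : editDist G (completePartite U) ≤ κ ^ 2 * G.edgeSet.ncard) :
    0 < (G.edgeSet.ncard : ℝ) := by
  have hr' : (2 : ℝ) ≤ r := Nat.ofNat_le_cast.2 hr
  have hH : 0 < 2 * ((completePartite U).edgeSet.ncard : ℝ) := by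
    rw [h.two_mul_ncard_edgeSet]
    have := h.pos hr
    have : (0 : ℝ) < r - 1 := by linarith
    positivity
  nlinarith [ncard_edgeSet_le_add_of_editDist_le hedit]

lemma two_mul_ncard_edgeSet_sdiff_le (h : IsBalanced U s) (hκ : κ ^ 2 ≤ 1 / 2)
    (hedit : editDist G (completePartite U) ≤ κ ^ 2 * G.edgeSet.ncard) :
    2 * ((completePartite U \ G).edgeSet.ncard : ℝ) ≤ 2 * κ ^ 2 * (r * s) ^ 2 := by
  rw [editDist_comm] at hedit
  have hm : (G.edgeSet.ncard : ℝ) ≤ 2 * (completePartite U).edgeSet.ncard := by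
    nlinarith [ncard_edgeSet_le_add_of_editDist_le hedit]
  calc 2 * ((completePartite U \ G).edgeSet.ncard : ℝ)
      ≤ 2 * (κ ^ 2 * (2 * (completePartite U).edgeSet.ncard)) := by
        gcongr
        exact (ncard_edgeSet_sdiff_le_of_editDist_le hedit).trans (by gcongr)
    _ = 2 * κ ^ 2 * (r * (r - 1) * s ^ 2) := by rw [h.two_mul_ncard_edgeSet]; ring
    _ ≤ 2 * κ ^ 2 * (r * s) ^ 2 := by
        gcongr
        nlinarith [r.cast_nonneg (α := ℝ), sq_nonneg s]

lemma mul_le_of_editDist_le (h : IsBalanced U s) (hr : 0 < r) (hκ : 0 ≤ κ)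
    (hedit : editDist G (completePartite U) ≤ κ ^ 2 * G.edgeSet.ncard) :
    (r - 1) * s ≤ (1 + κ) * √((1 - 1 / r) * (2 * G.edgeSet.ncard)) := by
  have hr' : (1 : ℝ) ≤ r := Nat.one_le_cast.2 hr
  have hr'' : 0 ≤ 1 - 1 / (r : ℝ) := sub_nonneg.2 (div_le_one_of_le₀ hr' (by positivity))
  refine le_of_sq_le_sq ?_ (by positivity)
  have hm : ((completePartite U).edgeSet.ncard : ℝ) ≤ (1 + κ) ^ 2 * G.edgeSet.ncard := by
    nlinarith [ncard_edgeSet_le_add_of_editDist_le hedit, G.edgeSet.ncard.cast_nonneg (α := ℝ)]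
  calc ((r - 1) * s) ^ 2 = (1 - 1 / r) * (2 * (completePartite U).edgeSet.ncard) :=
        (h.mul_two_mul_ncard_edgeSet hr).symm
    _ ≤ (1 - 1 / r) * (2 * ((1 + κ) ^ 2 * G.edgeSet.ncard)) := by gcongr
    _ = ((1 + κ) * √((1 - 1 / r) * (2 * G.edgeSet.ncard))) ^ 2 := by
        rw [mul_pow, Real.sq_sqrt (by positivity)]
        ring

end IsBalanced

end EditDist

section Closeness

variable {V : Type*} [Fintype V] {r : ℕ} {U : Fin r → Finset V} {s κ : ℝ} {G : SimpleGraph V}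

lemma sum_sub_sq_le_of_inner_sq {x z : V → ℝ} (hx : ∑ v, x v ^ 2 = 1) (hz : ∑ v, z v ^ 2 = 1)
    (hxz : 0 ≤ ∑ v, z v * x v) {δ : ℝ} (h : 1 - δ ≤ (∑ v, z v * x v) ^ 2) :
    ∑ v, (x v - z v) ^ 2 ≤ 2 * δ := by
  have hexp : ∑ v, (x v - z v) ^ 2 = 2 - 2 * ∑ v, z v * x v := by
    simp only [sub_sq, sum_add_distrib, sum_sub_distrib, hx, hz, mul_assoc, ← mul_sum,
      mul_comm (x _)]
    ring
  have hpos : 0 ≤ ∑ v, (x v - z v) ^ 2 := sum_nonneg fun v _ => sq_nonneg _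
  nlinarith

lemma sum_abs_sq_sub_sq_le {x z : V → ℝ} (hx : ∑ v, x v ^ 2 = 1) (hz : ∑ v, z v ^ 2 = 1) {ρ : ℝ}
    (hρ : 0 ≤ ρ) (h : ∑ v, (x v - z v) ^ 2 ≤ ρ ^ 2) : ∑ v, |x v ^ 2 - z v ^ 2| ≤ 2 * ρ := by
  have hadd : ∑ v, (x v + z v) ^ 2 ≤ 2 ^ 2 := by
    calc ∑ v, (x v + z v) ^ 2 ≤ ∑ v, 2 * (x v ^ 2 + z v ^ 2) := sum_le_sum fun v _ => add_sq_le
      _ = 2 ^ 2 := by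
        rw [← mul_sum, sum_add_distrib, hx, hz]
        norm_num
  refine le_of_sq_le_sq ?_ (by positivity)
  calc (∑ v, |x v ^ 2 - z v ^ 2|) ^ 2 = (∑ v, |x v + z v| * |x v - z v|) ^ 2 := by
        simp only [← abs_mul, ← sq_sub_sq]
    _ ≤ (∑ v, (x v + z v) ^ 2) * ∑ v, (x v - z v) ^ 2 := by
        simpa only [sq_abs] using
          sum_mul_sq_le_sq_mul_sq univ (fun v => |x v + z v|) (fun v => |x v - z v|)
    _ ≤ 2 ^ 2 * ρ ^ 2 := by gcongr
    _ = (2 * ρ) ^ 2 := (mul_pow _ _ _).symm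

lemma quadForm_sq_le_of_sum_sq_eq_one (G : SimpleGraph V) {x : V → ℝ} (hx : ∑ v, x v ^ 2 = 1) :
    quadForm G x ^ 2 ≤ 2 * G.edgeSet.ncard := by
  have hle : quadForm G (fun v => x v ^ 2) ≤ 1 := by
    calc quadForm G (fun v => x v ^ 2) ≤ ∑ p : V × V, x p.1 ^ 2 * x p.2 ^ 2 :=
          sum_le_univ_sum_of_nonneg fun p => by positivity
      _ = 1 := by simp only [Fintype.sum_prod_type, ← sum_mul_sum, hx, one_mul]
  exact (quadForm_sq_le G x).trans (mul_le_of_le_one_right (by positivity) hle)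

lemma quadForm_sdiff_le_of_editDist_le (hr : 2 ≤ r) (hκ : 0 ≤ κ) {K : SimpleGraph V}
    (hedit : editDist G K ≤ κ ^ 2 * G.edgeSet.ncard) {x : V → ℝ} (hx : ∑ v, x v ^ 2 = 1) :
    quadForm (G \ K) x ≤ 2 * κ * √((1 - 1 / r) * (2 * G.edgeSet.ncard)) := by
  have hr' : 1 / 2 ≤ 1 - 1 / (r : ℝ) := by
    linarith [one_div_le_one_div_of_le two_pos (Nat.ofNat_le_cast.2 hr : (2 : ℝ) ≤ r)]
  refine le_of_sq_le_sq ?_ (by positivity)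
  calc quadForm (G \ K) x ^ 2 ≤ 2 * (G \ K).edgeSet.ncard := quadForm_sq_le_of_sum_sq_eq_one _ hx
    _ ≤ 2 * (κ ^ 2 * G.edgeSet.ncard) := by
        gcongr
        exact ncard_edgeSet_sdiff_le_of_editDist_le hedit
    _ ≤ (2 * κ) ^ 2 * (1 / 2 * (2 * G.edgeSet.ncard)) := by
        nlinarith [mul_nonneg (sq_nonneg κ) (G.edgeSet.ncard.cast_nonneg (α := ℝ))]
    _ ≤ (2 * κ) ^ 2 * ((1 - 1 / r) * (2 * G.edgeSet.ncard)) := by gcongr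
    _ = (2 * κ * √((1 - 1 / r) * (2 * G.edgeSet.ncard))) ^ 2 := by
        rw [mul_pow _ √_, Real.sq_sqrt]
        exact mul_nonneg (by linarith) (by positivity)

namespace IsBalanced

lemma sum_sub_partVector_sq_le (h : IsBalanced U s) (hr : 2 ≤ r) (hκ : 0 ≤ κ)
    (hedit : editDist G (completePartite U) ≤ κ ^ 2 * G.edgeSet.ncard) {x : V → ℝ}
    (hx0 : ∀ v, 0 ≤ x v) (hx : ∑ v, x v ^ 2 = 1)
    (hq : (1 - 1 / r) * (2 * G.edgeSet.ncard) ≤ quadForm G x ^ 2) :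
    ∑ v, (x v - partVector U v) ^ 2 ≤ 8 * κ := by
  have hr' : (2 : ℝ) ≤ r := Nat.ofNat_le_cast.2 hr
  set p := ∑ v, partVector U v * x v
  set a := √((1 - 1 / r) * (2 * G.edgeSet.ncard))
  have hlower : (1 - 2 * κ) * a ≤ quadForm (completePartite U) x := by
    linarith [quadForm_add_quadForm_sdiff G (completePartite U) x,
      quadForm_nonneg (completePartite U \ G) hx0, quadForm_sdiff_le_of_editDist_le hr hκ hedit hx,
      Real.sqrt_le_iff.2 ⟨quadForm_nonneg G hx0, hq⟩]
  have hs : (r - 1) * s ≤ (1 + κ) * a := h.mul_le_of_editDist_le (by lia) hκ hedit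
  have ha : 0 < a := by
    have : 0 < (r - 1) * s := mul_pos (by linarith) (h.pos hr)
    exact pos_of_mul_pos_right (this.trans_le hs) (by positivity)
  have hp : 1 - 4 * κ ≤ p ^ 2 := by
    have hchain : (1 - 2 * κ) * a ≤ (1 + κ) * p ^ 2 * a := by
      calc (1 - 2 * κ) * a ≤ (r - 1) * s * p ^ 2 := hlower.trans (h.quadForm_le_mul_inner_sq hr x)
        _ ≤ (1 + κ) * a * p ^ 2 := by gcongr
        _ = (1 + κ) * p ^ 2 * a := by ring
    nlinarith [le_of_mul_le_mul_right hchain ha]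
  have hclose := sum_sub_sq_le_of_inner_sq hx (h.sum_partVector_sq (by lia))
    (sum_nonneg fun v _ => mul_nonneg (partVector_nonneg U v) (hx0 v)) hp
  linarith

lemma quadForm_sdiff_partVector_sq (h : IsBalanced U s) (G : SimpleGraph V) :
    quadForm (completePartite U \ G) (fun v => partVector U v ^ 2) =
      2 * (completePartite U \ G).edgeSet.ncard / (r * s) ^ 2 := by
  have hmul := quadForm_mul (completePartite U \ G) (a := fun v => partVector U v ^ 2)
    (fun u v huv => h.partVector_sq_mul_partVector_sq huv.1) 1
  simpa only [Pi.one_apply, mul_one, quadForm_one, one_div_mul_eq_div] using hmul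

lemma nearPartite (h : IsBalanced U s) (hr : 2 ≤ r) {β ρ : ℝ} (hβ0 : 0 < β) (hβ1 : β ≤ 1)
    (hρ0 : 0 ≤ ρ) (hρ : 5 * ρ ≤ β ^ 2) (hcard : ∀ i, 2 / β ≤ #(U i))
    (hsdiff : 2 * (completePartite U \ G).edgeSet.ncard ≤ ρ * (r * s) ^ 2) {x : V → ℝ}
    (hx : ∑ v, x v ^ 2 = 1) (hclose : ∑ v, (x v - partVector U v) ^ 2 ≤ ρ ^ 2) :
    NearPartite G (fun v => x v ^ 2) U β := by
  have hz := h.sum_partVector_sq (by lia)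
  have hdist := sum_abs_sq_sub_sq_le hx hz hρ0 hclose
  refine ⟨hβ0, fun v => sq_nonneg _, hx, fun v => ?_, h.disjoint, fun i => ?_, ?_⟩
  · have hv : (x v - partVector U v) ^ 2 ≤ ρ ^ 2 :=
      (single_le_sum (fun v _ => sq_nonneg (x v - partVector U v)) (mem_univ v)).trans hclose
    have hρβ : ρ ≤ β / 5 := by nlinarith
    have hρβ' : ρ ^ 2 ≤ β / 4 := by nlinarith
    nlinarith [h.partVector_sq_le hr hβ0 hcard v, sq_nonneg (x v - 2 * partVector U v)]
  · have hpart : ∑ v ∈ U i, (partVector U v ^ 2 - x v ^ 2) ≤ 2 * ρ :=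
      calc ∑ v ∈ U i, (partVector U v ^ 2 - x v ^ 2) ≤ ∑ v ∈ U i, |x v ^ 2 - partVector U v ^ 2| :=
            sum_le_sum fun v _ => abs_sub_comm (x v ^ 2) _ ▸ le_abs_self _
        _ ≤ 2 * ρ := (sum_le_univ_sum_of_nonneg fun v => abs_nonneg _).trans hdist
    rw [sum_sub_distrib, ← mass_coe, ← mass_coe, h.mass_partVector_sq] at hpart
    linarith
  · have hrs : 0 < (r * s) ^ 2 := pow_pos (mul_pos (Nat.cast_pos.2 (by lia)) (h.pos hr)) 2
    have hzq : quadForm (completePartite U \ G) (fun v => partVector U v ^ 2) ≤ ρ := by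
      rwa [h.quadForm_sdiff_partVector_sq, div_le_iff₀ hrs]
    linarith [quadForm_le_add_two_mul_sum_abs (completePartite U \ G) (fun v => sq_nonneg (x v)) hx
      (fun v => sq_nonneg (partVector U v)) hz]

/-- The error parameters are chained: an edit distance of `κ ^ 2 * m` makes `x` and the Perron
vector `ρ`-close for `8 * κ = ρ ^ 2`, which in turn makes `G` near-partite up to `β`. -/
lemma nearPartite_of_editDist_le (h : IsBalanced U s) (hr : 2 ≤ r) {β ρ : ℝ} (hβ0 : 0 < β)
    (hβ1 : β ≤ 1) (hρ : 5 * ρ = β ^ 2) (hκ : 8 * κ = ρ ^ 2) (hcard : ∀ i, 2 / β ≤ #(U i))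
    (hedit : editDist G (completePartite U) ≤ κ ^ 2 * G.edgeSet.ncard) {x : V → ℝ}
    (hx0 : ∀ v, 0 ≤ x v) (hx : ∑ v, x v ^ 2 = 1)
    (hq : (1 - 1 / r) * (2 * G.edgeSet.ncard) ≤ quadForm G x ^ 2) :
    NearPartite G (fun v => x v ^ 2) U β := by
  have hρ0 : 0 ≤ ρ := by nlinarith
  have hρ1 : ρ ≤ 1 / 5 := by nlinarith
  have hκ0 : 0 ≤ κ := by nlinarith
  have hκρ : 8 * κ ≤ ρ := by nlinarith
  refine h.nearPartite hr hβ0 hβ1 hρ0 hρ.le hcard ?_ hx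
    (hκ ▸ h.sum_sub_partVector_sq_le hr hκ0 hedit hx0 hx hq)
  refine (h.two_mul_ncard_edgeSet_sdiff_le (by nlinarith) hedit).trans ?_
  gcongr
  nlinarith

end IsBalanced

end Closeness

section Extremal

variable {V : Type*} {r t : ℕ} {G : SimpleGraph V} {x : V → ℝ}

lemma pos_of_adj_of_mul_eq (hx : ∀ v, 0 ≤ x v) {c : ℝ} (hc : 0 < c)
    (hprod : ∀ u v, G.Adj u v → x u * x v = c) {u v : V} (huv : G.Adj u v) : 0 < x u :=
  pos_of_mul_pos_left ((hprod u v huv).symm ▸ hc) (hx v)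

/-- Two vertices have a common neighbour in a third part, so that `x` is constant. -/
lemma regularOn_completePartite_of_mul_eq (hr : 3 ≤ r) {W : Fin r → Finset V}
    (hW : Pairwise (Function.onFun Disjoint W)) (hne : ∀ i, (W i).Nonempty)
    (hx : ∀ i, ∀ v ∈ W i, 0 < x v) {c b : ℝ}
    (hprod : ∀ u v, (completePartite W).Adj u v → x u * x v = c)
    (hb : ∀ i, ∑ v ∈ W i, x v ^ 2 = b) :
    RegularOn (completePartite W) (⋃ i, (W i : Set V)) := by
  have hconst {i j : Fin r} {u v : V} (hu : u ∈ W i) (hv : v ∈ W j) : x v = x u := by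
    obtain ⟨k, hk⟩ := exists_mem_notMem_of_card_lt_card
      (s := {i, j}) (t := univ) (card_le_two.trans_lt (by rwa [card_univ, Fintype.card_fin]))
    obtain ⟨-, hki, hkj⟩ : k ∈ univ ∧ k ≠ i ∧ k ≠ j := by simpa using hk
    obtain ⟨w, hw⟩ := hne k
    have huw := hprod u w ((completePartite_adj_iff hW hu).2 ⟨k, hki.symm, hw⟩)
    have hvw := hprod v w ((completePartite_adj_iff hW hv).2 ⟨k, hkj.symm, hw⟩)
    exact mul_right_cancel₀ (hx k w hw).ne' (hvw.trans huw.symm)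
  let o : Fin r := ⟨0, by lia⟩
  obtain ⟨u, hu⟩ := hne o
  have hcard (i : Fin r) : (#(W i) : ℝ) * x u ^ 2 = b := by
    rw [← hb i, sum_congr rfl fun v hv => by rw [hconst hu hv], sum_const, nsmul_eq_mul]
  refine regularOn_completePartite hW (k := #(W o)) fun i => ?_
  exact_mod_cast mul_right_cancel₀ (pow_pos (hx o u hu) 2).ne' ((hcard i).trans (hcard o).symm)

variable [Fintype V]

lemma exists_pos_mul_eq_of_le_quadForm_sq (hx : ∀ v, 0 ≤ x v) (hq : quadForm G x ≠ 0)
    (h : 2 * G.edgeSet.ncard * quadForm G (fun v => x v ^ 2) ≤ quadForm G x ^ 2) :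
    ∃ c, 0 < c ∧ ∀ u v, G.Adj u v → x u * x v = c := by
  obtain ⟨p, hp, hne⟩ := exists_ne_zero_of_sum_ne_zero hq
  exact ⟨x p.1 * x p.2, (mul_nonneg (hx _) (hx _)).lt_of_ne' hne,
    fun u v huv => mul_eq_mul_of_le_quadForm_sq h huv (mem_adjPairs.1 hp)⟩

lemma exists_parts_of_coloring (hr : 0 < r) (hx : ∀ v, 0 ≤ x v)
    (hpos : ∀ u v, G.Adj u v → 0 < x u) {f : V → Fin r}
    (hmass : ∀ i, mass (fun v => x v ^ 2) (f ⁻¹' {i}) = 1 / r)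
    (hadj : ∀ u v, 0 < x u → 0 < x v → (G.Adj u v ↔ f u ≠ f v)) :
    ∃ W : Fin r → Finset V, (∀ i, (W i).Nonempty) ∧ Pairwise (Function.onFun Disjoint W) ∧
      G = completePartite W ∧ (∀ i, ∀ v ∈ W i, 0 < x v) ∧
      ∀ i, ∑ v ∈ W i, x v ^ 2 = 1 / r := by
  classical
  let W (i : Fin r) : Finset V := {v | f v = i ∧ 0 < x v}
  have hW {i : Fin r} {v : V} : v ∈ W i ↔ f v = i ∧ 0 < x v := by simp [W]
  have hsum (i : Fin r) : ∑ v ∈ W i, x v ^ 2 = 1 / r := by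
    rw [← hmass i, mass_eq_sum_filter]
    refine sum_subset (fun v hv => by simpa using (hW.1 hv).1) fun v hv hv' => ?_
    have hfv : f v = i := by simpa using hv
    have hxv : x v = 0 := (hx v).antisymm' (not_lt.1 fun h => hv' (hW.2 ⟨hfv, h⟩))
    rw [hxv, zero_pow two_ne_zero]
  refine ⟨W, fun i => ?_, fun i j hij => disjoint_left.2 fun v hi hj => ?_, ?_,
    fun i v hv => (hW.1 hv).2, hsum⟩
  · exact nonempty_of_sum_ne_zero ((hsum i).trans_ne (by positivity))
  · exact hij ((hW.1 hi).1.symm.trans (hW.1 hj).1)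
  · ext u v
    refine ⟨fun huv => ?_, fun ⟨_, i, j, hij, hu, hv⟩ => ?_⟩
    · have hxu := hpos u v huv
      have hxv := hpos v u huv.symm
      exact ⟨huv.ne, f u, f v, (hadj u v hxu hxv).1 huv, hW.2 ⟨rfl, hxu⟩, hW.2 ⟨rfl, hxv⟩⟩
    · obtain ⟨rfl, hxu⟩ := hW.1 hu
      obtain ⟨rfl, hxv⟩ := hW.1 hv
      exact (hadj u v hxu hxv).2 hij

variable {U : Fin r → Finset V} {β : ℝ}

namespace NearPartite

lemma quadForm_sq_le_mul (h : NearPartite G (fun v => x v ^ 2) U β) (hr : 0 < r) (ht : 0 < t)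
    (hβ : 100 * (r * t * β) ≤ 1 / r) (hfree : (blowupPlus r t).Free G) :
    quadForm G x ^ 2 ≤ (1 - 1 / r) * (2 * G.edgeSet.ncard) := by
  rw [mul_comm]
  exact (quadForm_sq_le G x).trans
    (mul_le_mul_of_nonneg_left (h.quadForm_le hr ht hβ hfree) (by positivity))

lemma isCompletePartite (h : NearPartite G (fun v => x v ^ 2) U β) (hr : 2 ≤ r) (ht : 0 < t)
    (hβ : 100 * (r * t * β) ≤ 1 / r) (hfree : (blowupPlus r t).Free G)
    (hm : 0 < (G.edgeSet.ncard : ℝ)) (hx : ∀ v, 0 ≤ x v)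
    (hq : (1 - 1 / r) * (2 * G.edgeSet.ncard) ≤ quadForm G x ^ 2) :
    IsCompletePartite r G ∧ (3 ≤ r → IsRegularCompletePartite r G) := by
  have hr0 : 0 < r := by lia
  have hr1 : 0 < 1 - 1 / (r : ℝ) :=
    sub_pos.2 ((div_lt_one (Nat.cast_pos.2 hr0)).2 (Nat.one_lt_cast.2 hr))
  have hge : 1 - 1 / (r : ℝ) ≤ quadForm G (fun v => x v ^ 2) := by
    refine le_of_mul_le_mul_left ?_ (mul_pos two_pos hm)
    linarith [quadForm_sq_le G x]
  have heq := (h.quadForm_le hr0 ht hβ hfree).antisymm hge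
  have hq0 : quadForm G x ≠ 0 := fun h0 => by
    rw [h0, zero_pow two_ne_zero] at hq
    exact hq.not_gt (by positivity)
  obtain ⟨c, hc, hprod⟩ := exists_pos_mul_eq_of_le_quadForm_sq hx hq0 (by rwa [heq, mul_comm])
  obtain ⟨f, hmass, hadj⟩ := h.exists_coloring_of_le_quadForm hr0 ht hβ hfree hge
  obtain ⟨W, hne, hW, rfl, hpos, hsum⟩ := exists_parts_of_coloring hr0 hx
    (fun _ _ => pos_of_adj_of_mul_eq hx hc hprod) hmass fun u v hu hv =>
      hadj u v (pow_pos hu 2) (pow_pos hv 2)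
  exact ⟨⟨W, hne, hW, rfl⟩, fun h3 =>
    ⟨W, hne, hW, rfl, regularOn_completePartite_of_mul_eq h3 hW hne hpos hprod hsum⟩⟩

end NearPartite

lemma isCompletePartite_of_le_lam_sq {s ρ κ : ℝ} {U : Fin r → Finset V} (h : IsBalanced U s)
    (hr : 2 ≤ r) (ht : 0 < t) (hβ0 : 0 < β) (hβ : 100 * (r * t * β) ≤ 1 / r) (hρ : 5 * ρ = β ^ 2)
    (hκ : 8 * κ = ρ ^ 2) (hcard : ∀ i, 2 / β ≤ #(U i)) (hfree : (blowupPlus r t).Free G)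
    (hedit : editDist G (completePartite U) ≤ κ ^ 2 * G.edgeSet.ncard)
    (hle : (1 - 1 / (r : ℝ)) * (2 * G.edgeSet.ncard) ≤ lam G ^ 2) :
    lam G ^ 2 = (1 - 1 / (r : ℝ)) * (2 * G.edgeSet.ncard) ∧
      IsCompletePartite r G ∧ (3 ≤ r → IsRegularCompletePartite r G) := by
  have : Nonempty V := ⟨(h.nonempty ⟨0, by lia⟩).choose⟩
  have hm := h.ncard_edgeSet_pos_of_editDist_le hr hedit
  obtain ⟨x, hx0, hx, hlam⟩ := exists_unit_vector_lam_le G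
  have hlam2 : lam G ^ 2 ≤ quadForm G x ^ 2 := pow_le_pow_left₀ (lam_nonneg G) hlam 2
  have hβ1 : β ≤ 1 := by
    have hrt : (1 : ℝ) ≤ r * t := by exact_mod_cast Nat.mul_pos (by lia : 0 < r) ht
    have hr1 : 1 / (r : ℝ) ≤ 1 := one_div (r : ℝ) ▸ Nat.cast_inv_le_one r
    nlinarith
  have hnear := h.nearPartite_of_editDist_le hr hβ0 hβ1 hρ hκ hcard hedit hx0 hx
    (hle.trans hlam2)
  exact ⟨(hlam2.trans (hnear.quadForm_sq_le_mul (by lia) ht hβ hfree)).antisymm hle,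
    hnear.isCompletePartite hr ht hβ hfree hm hx0 (hle.trans hlam2)⟩

end Extremal

end EdgeSpectral

theorem theorem3p1 (t r : ℕ) (ht : 2 ≤ t) (hr : 2 ≤ r) :
    ∃ (ε : ℝ) (n₀ : ℕ), 0 < ε ∧
      ∀ (V : Type*) [Fintype V] (G : SimpleGraph V) (m : ℕ) (U : Fin r → Finset V),
        (EdgeSpectral.blowupPlus r t).Free G →
        G.edgeSet.ncard = m →
        Pairwise (Function.onFun Disjoint U) →
        (∀ i, n₀ ≤ (U i).card) →
        (3 ≤ r → EdgeSpectral.RegularOn (EdgeSpectral.completePartite U)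
          (⋃ i, (U i : Set V))) →
        (EdgeSpectral.editDist G (EdgeSpectral.completePartite U) : ℝ) ≤ ε * m →
        EdgeSpectral.lam G ^ 2 ≤ (1 - 1 / (r : ℝ)) * (2 * m) ∧
        (r = 2 → (EdgeSpectral.lam G ^ 2 = (1 - 1 / (r : ℝ)) * (2 * m) ↔
          EdgeSpectral.IsCompletePartite 2 G)) ∧
        (3 ≤ r → (EdgeSpectral.lam G ^ 2 = (1 - 1 / (r : ℝ)) * (2 * m) ↔
          EdgeSpectral.IsRegularCompletePartite r G)) := by
  have : (0 : ℝ) < r := Nat.cast_pos.2 (by lia)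
  have : (0 : ℝ) < t := Nat.cast_pos.2 (by lia)
  obtain ⟨β, hβ0, hβ⟩ : ∃ β : ℝ, 0 < β ∧ 100 * (r * t * β) ≤ 1 / r :=
    ⟨1 / (100 * (r * t) * r), by positivity, by field_simp; rfl⟩
  refine ⟨((β ^ 2 / 5) ^ 2 / 8) ^ 2, ⌈2 / β⌉₊, by positivity, ?_⟩
  rintro V _ G m U hfree rfl hU hcard hreg hedit
  have hcard' (i : Fin r) : 2 / β ≤ (U i).card := Nat.ceil_le.1 (hcard i)
  have hne (i : Fin r) : (U i).Nonempty :=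
    Finset.card_pos.1 (Nat.cast_pos.1 ((div_pos two_pos hβ0).trans_le (hcard' i)))
  obtain ⟨s, hs⟩ := EdgeSpectral.exists_isBalanced hr hU hne hreg
  have hextr := EdgeSpectral.isCompletePartite_of_le_lam_sq hs hr (by lia) hβ0 hβ
    (ρ := β ^ 2 / 5) (κ := (β ^ 2 / 5) ^ 2 / 8) (by ring) (by ring) hcard' hfree hedit
  have hle := le_of_not_gt fun hlt => hlt.ne' (hextr hlt.le).1
  refine ⟨hle, ?_, fun h3 => ⟨fun heq => (hextr heq.ge).2.2 h3, ?_⟩⟩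
  · rintro rfl
    refine ⟨fun heq => (hextr heq.ge).2.1, ?_⟩
    rintro ⟨W, hWne, hW, rfl⟩
    exact hle.antisymm (EdgeSpectral.le_lam_sq_completePartite hr hW hWne (by lia))
  · rintro ⟨W, hWne, hW, rfl, hWreg⟩
    exact hle.antisymm (EdgeSpectral.le_lam_sq_completePartite hr hW hWne fun _ => hWreg)
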